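/- **Theorem 3.1.** Let $(T,M,\mu)$ be a measure space with $\sigma$-finite separable measure $\mu$, let $(L,\|\cdot\|_L)$ be a rearrangement invariant Banach function space over it (of real or complex functions; $L$ need not be separable; its norm is given by a function norm with the Fatou property), let $L'$ be the associate space with norm $\|g\|_{L'}=\sup_{\|f\|_L\le1}\int_T|fg|\,d\mu$, and let $S$ be the set of extremal points of the unit ball of $L'$. Suppose that $S$ is norming: $$\|f\|_L=\sup_{g\in S}\mathrm{Re}\int_T fg\,d\mu\qquad(f\in L).$$ Let $1\le a<b\le\infty$, let $\psi:(a,b)\to[1,\infty)$ be continuous, and put $\|\eta\|_{G\psi}=\sup_{a<p<b}(\mathbf E|\eta|^p)^{1/p}/\psi(p)$ for random variables $\eta$ on a probability space $(\Omega,\mathcal B,\mathbf P)$. Put $v(y)=\ln\psi(1/y)$ for $1/b<y<1/a$, $v(y)=+\infty$ for all other $y\ge0$, and $v_*(x)=\inf_{y\ge0}(xy+v(y))$, with $v_*(\infty)=\infty$. For a semi-distance $d$ on a set $X$ let $N(X,d,\epsilon)\in\{1,2,\dots,\infty\}$ be the minimal number of closed $d$-balls of radius $\epsilon$ covering $X$.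 Let $\xi(t)=\xi(t,\omega)$, $t\in T$, be a jointly measurable random process on $(\Omega,\mathcal B,\mathbf P)$ with $\sup_{t\in T}\|\xi(t)\|_{G\psi}=1$, such that for every $g\in L'$ the integral $l_\xi(g)=\int_T\xi(t)g(t)\,\mu(dt)$ exists with probability one. Put $d_\psi(t,s)=\|\xi(t)-\xi(s)\|_{G\psi}$ on $T$, $d_\psi(g_1,g_2)=\|l_\xi(g_1)-l_\xi(g_2)\|_{G\psi}$ on $S$, and $D=\sup_{g_1,g_2\in S}\int_T|g_1-g_2|\,d\mu\in[0,\infty]$. (i) If $$\int_0^D\exp\bigl(v_*(2+\ln N(T,d_\psi,\epsilon))\bigr)\,d\epsilon<\infty,$$ then $\mathbf P(\xi(\cdot)\in L)=1$. (ii) If $$I:=\int_0^D\exp\bigl(v_*(2+\ln N(S,d_\psi,\epsilon))\bigr)\,d\epsilon<\infty,$$ then $\mathbf P(\xi(\cdot)\in L)=1$, $\|\xi\|_L$ is a random variable (up to a $\mathbf P$-null set), and $\bigl\|\,\|\xi\|_L\,\bigr\|_{G\psi}\le 9I$. -/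

import Mathlib

open MeasureTheory Set
open scoped ENNReal NNReal

noncomputable section

/-- A rearrangement invariant Banach function norm over the measure space `(T, μ)`: a functional on
the nonnegative extended measurable functions (its values at non-measurable functions are
irrelevant) with the usual axioms, including the Fatou property, which takes equal values at
equimeasurable functions. -/
structure RINorm {T : Type*} [MeasurableSpace T] (μ : Measure T) where
  toFun : (T → ℝ≥0∞) → ℝ≥0∞
  eq_zero_iff : ∀ f, Measurable f → (toFun f = 0 ↔ f =ᵐ[μ] 0)
  smul : ∀ (c : ℝ≥0) (f : T → ℝ≥0∞), Measurable f → toFun (fun t => c * f t) = c * toFun f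
  add_le : ∀ f g, Measurable f → Measurable g → toFun (f + g) ≤ toFun f + toFun g
  mono : ∀ f g, Measurable f → Measurable g → f ≤ᵐ[μ] g → toFun f ≤ toFun g
  fatou : ∀ f : ℕ → T → ℝ≥0∞, (∀ n, Measurable (f n)) → Monotone f →
    toFun (fun t => ⨆ n, f n t) = ⨆ n, toFun (f n)
  indicator_lt_top : ∀ E, MeasurableSet E → μ E < ∞ → toFun (E.indicator 1) < ∞
  lintegral_le : ∀ E, MeasurableSet E → μ E < ∞ →
    ∃ C : ℝ≥0, ∀ f, Measurable f → ∫⁻ t in E, f t ∂μ ≤ C * toFun f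
  rearrangement : ∀ f g, Measurable f → Measurable g → (∀ᵐ t ∂μ, f t < ∞) → (∀ᵐ t ∂μ, g t < ∞) →
    (∀ s : ℝ≥0, μ {t | (s : ℝ≥0∞) < f t} = μ {t | (s : ℝ≥0∞) < g t}) → toFun f = toFun g

namespace RINorm

variable {T : Type*} [MeasurableSpace T] {μ : Measure T} (L : RINorm μ)

/-- The norm `‖f‖_L` of a scalar function, with values in `[0, ∞]`. -/
def norm {𝕜 : Type*} [RCLike 𝕜] (f : T → 𝕜) : ℝ≥0∞ := L.toFun (fun t => ‖f t‖ₑ)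

/-- `f` belongs to the space `L`. -/
def Mem {𝕜 : Type*} [RCLike 𝕜] (f : T → 𝕜) : Prop := Measurable f ∧ L.norm f < ∞

/-- The norm `‖g‖_{L'}` in the associate space: the supremum of `∫ |f g| dμ` over `‖f‖_L ≤ 1`. -/
def assocNorm {𝕜 : Type*} [RCLike 𝕜] (g : T →ₘ[μ] 𝕜) : ℝ≥0∞ :=
  ⨆ (f : T → ℝ≥0∞) (_ : Measurable f) (_ : L.toFun f ≤ 1), ∫⁻ t, f t * ‖g t‖ₑ ∂μ

/-- The associate space `L'`. -/
def assoc (𝕜 : Type*) [RCLike 𝕜] : Set (T →ₘ[μ] 𝕜) := {g | L.assocNorm g < ∞}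

/-- The set `S` of all extremal points of the unit ball of the associate space. -/
def extremalSet (𝕜 : Type*) [RCLike 𝕜] : Set (T →ₘ[μ] 𝕜) :=
  Set.extremePoints ℝ {g : T →ₘ[μ] 𝕜 | L.assocNorm g ≤ 1}

/-- The extremal points of the unit ball of `L'` recover the norm of every element of `L`. -/
def ExtremalNorming (𝕜 : Type*) [RCLike 𝕜] : Prop :=
  ∀ f : T → 𝕜, L.Mem f →
    L.norm f = ⨆ g ∈ L.extremalSet 𝕜, ENNReal.ofReal (RCLike.re (∫ t, f t * g t ∂μ))

/-- The diameter `D` of the set `S` in the `L¹(μ)` distance `ρ(g₁, g₂) = ∫ |g₁ - g₂| dμ`. -/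
def extremalDiam (𝕜 : Type*) [RCLike 𝕜] : ℝ≥0∞ :=
  ⨆ (g₁ ∈ L.extremalSet 𝕜) (g₂ ∈ L.extremalSet 𝕜), ∫⁻ t, ‖g₁ t - g₂ t‖ₑ ∂μ

end RINorm

/-- The real exponents `p` with `a < p < b`, where `b` may be `∞`. -/
def expInterval (a : ℝ) (b : EReal) : Set ℝ := {p | a < p ∧ (p : EReal) < b}

/-- `ψ` is a generating function with support `(a, b)`, `1 ≤ a < b ≤ ∞`, normalised by `ψ ≥ 1`. -/
structure IsGeneratingFunction (ψ : ℝ → ℝ) (a : ℝ) (b : EReal) : Prop where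
  one_le_left : 1 ≤ a
  left_lt_right : (a : EReal) < b
  continuousOn : ContinuousOn ψ (expInterval a b)
  one_le : ∀ p ∈ expInterval a b, 1 ≤ ψ p

/-- The grand Lebesgue norm `‖η‖_{Gψ} = sup_{a < p < b} (E|η|^p)^{1/p} / ψ(p)`. -/
def gpsiNorm (ψ : ℝ → ℝ) (a : ℝ) (b : EReal) {Ω : Type*} [MeasurableSpace Ω] (P : Measure Ω)
    {E : Type*} [ENorm E] (η : Ω → E) : ℝ≥0∞ :=
  ⨆ p ∈ expInterval a b, eLpNorm η (ENNReal.ofReal p) P / ENNReal.ofReal (ψ p)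

/-- The minimal number of closed balls of radius `ε` for the semi-distance `d` which cover `X`
(`⊤` if there is no finite cover). -/
def entropyNumber {X : Type*} (d : X → X → ℝ≥0∞) (ε : ℝ) : ℕ∞ :=
  ⨅ (C : Set X) (_ : ∀ x, ∃ c ∈ C, d c x ≤ ENNReal.ofReal ε), C.encard

open Classical in
/-- The function `v(y) = ln ψ(1/y)`, equal to `+∞` where `1/y` is outside the support of `ψ`. -/
def logGen (ψ : ℝ → ℝ) (a : ℝ) (b : EReal) (y : ℝ) : EReal :=
  if 1 / y ∈ expInterval a b then ((Real.log (ψ (1 / y)) : ℝ) : EReal) else ⊤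

/-- The Young-Fenchel co-transform `f_*(x) = inf_{y ≥ 0} (x y + f(y))`. -/
def coTransform (f : ℝ → EReal) (x : EReal) : EReal :=
  ⨅ (y : ℝ) (_ : 0 ≤ y), (x * (y : EReal) + f y)

/-- The integral of `exp (v_*(2 + ln N(X, d, ε)))` over `0 < ε ≤ D`. -/
def entropyIntegral (ψ : ℝ → ℝ) (a : ℝ) (b : EReal) (D : ℝ≥0∞) {X : Type*}
    (d : X → X → ℝ≥0∞) : ℝ≥0∞ :=
  ∫⁻ ε in {ε : ℝ | 0 < ε ∧ ENNReal.ofReal ε ≤ D},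
    EReal.exp (coTransform (logGen ψ a b) (2 + ENNReal.log ((entropyNumber d ε : ℕ∞) : ℝ≥0∞)))

/-- The natural semi-distance `d_ψ(x, y) = ‖X(x) - X(y)‖_{Gψ}` of a random field on its index
set. -/
def naturalDist (ψ : ℝ → ℝ) (a : ℝ) (b : EReal) {Ω : Type*} [MeasurableSpace Ω] (P : Measure Ω)
    {𝕜 : Type*} [RCLike 𝕜] {X : Type*} (Y : X → Ω → 𝕜) (x y : X) : ℝ≥0∞ :=
  gpsiNorm ψ a b P (fun ω => Y x ω - Y y ω)

/-- The random functional `l_ξ(g) = ∫ ξ(t) g(t) μ(dt)`. -/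
def pathFunctional {T Ω : Type*} [MeasurableSpace T] {μ : Measure T} {𝕜 : Type*} [RCLike 𝕜]
    (ξ : T → Ω → 𝕜) (g : T →ₘ[μ] 𝕜) (ω : Ω) : 𝕜 :=
  ∫ t, ξ t ω * g t ∂μ

end

/-! Write w(N) for `entropyWeight`, the infimum over q in (a, b) of (e²N)^{1/q} ψ(q). The maximum of
N variables of Gψ norm at most δ has Gψ norm at most δ w(N) (`gpsiNorm_iSup_finset_le`). Chaining
through nets of radii D/2^{k+1} then gives a single random variable Z that dominates each member of
the field almost surely, with Gψ norm bounded by a multiple of the entropy integral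
(`exists_majorant_of_entropyIntegral`). Since w ≥ 1, finiteness of the integral forces D < ∞. By
symmetry of S every g in S has ∫|g| ≤ D, and the norming property then gives ‖1‖_L ≤ D, so bounded
functions lie in L.

For (i), chain over T: by Fubini almost every path is bounded by Z(ω) for almost every t, hence lies
in L.

For (ii), chain over S. The difficulty is that |l_ξ(g)| ≤ Z holds only almost surely for each g
separately, while the norming formula applies only to elements of L, which the paths are not yet
known to be. Truncated paths are bounded, so they are in L, and by separability of L¹ and the Fatou
property the norm of a path is a countable supremum of pairings of truncations with elements of S
(`exists_seq_norm_eq`). The truncation depends on ω, so these pairings are bounded by ∫|ξ g| dμ,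
which is recovered from countably many pairings ∫ ξ g h with |h| ≤ 1 (`exists_seq_norming_L1`). That
Z also dominates those, although gh need not be in S, follows by duality (`ae_enorm_integral_le`):
averaging over ω turns the claim into an inequality for the deterministic function φ(t) = E ζ ξ(t),
which is bounded and hence in L. -/

/-- The weight `exp (v_*(2 + ln N))` in the entropy integral. -/
noncomputable def entropyWeight (ψ : ℝ → ℝ) (a : ℝ) (b : EReal) (N : ℝ≥0∞) : ℝ≥0∞ :=
  EReal.exp (coTransform (logGen ψ a b) (2 + ENNReal.log N))

/-! ### The entropy weight as an infimum over single exponents. -/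

section Weight

variable {ψ : ℝ → ℝ} {a : ℝ} {b : EReal}

/-- The exponential is an order isomorphism from the extended reals onto [0, ∞], so it passes
through the infimum and turns the sum into a product; y plays the role of 1/q. -/
lemma entropyWeight_eq (N : ℝ≥0∞) :
    entropyWeight ψ a b N =
      ⨅ (y : ℝ) (_ : 0 ≤ y), (EReal.exp 2 * N) ^ y * EReal.exp (logGen ψ a b y) := by
  rw [entropyWeight, coTransform, ← EReal.expOrderIso_apply, OrderIso.map_iInf]
  refine iInf_congr fun y => ?_
  rw [OrderIso.map_iInf]
  refine iInf_congr fun _ => ?_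
  rw [EReal.expOrderIso_apply, EReal.exp_add, EReal.exp_mul, EReal.exp_add, ENNReal.exp_log]

lemma entropyWeight_mono : Monotone (entropyWeight ψ a b) := by
  intro M N h
  simp only [entropyWeight_eq]
  gcongr

lemma one_le_ennreal_rpow {x : ℝ≥0∞} {y : ℝ} (hy : 0 ≤ y) (hx : 1 ≤ x) : 1 ≤ x ^ y := by
  simpa using ENNReal.rpow_le_rpow hx hy

lemma one_le_exp_two : 1 ≤ EReal.exp 2 := by
  rw [EReal.one_le_exp_iff]; norm_num

lemma exp_logGen (y : ℝ) (hψ : IsGeneratingFunction ψ a b) :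
    EReal.exp (logGen ψ a b y) = ⊤ ∨
      (0 < y ∧ 1 / y ∈ expInterval a b ∧
        EReal.exp (logGen ψ a b y) = ENNReal.ofReal (ψ (1 / y))) := by
  by_cases h : 1 / y ∈ expInterval a b
  · right
    have h0 : 0 < 1 / y := lt_of_lt_of_le (by linarith [hψ.one_le_left]) h.1.le
    have h1 := hψ.one_le _ h
    refine ⟨by simpa using h0, h, ?_⟩
    rw [logGen, if_pos h, EReal.exp_coe, Real.exp_log (by linarith)]
  · left; rw [logGen, if_neg h, EReal.exp_top]

/-- To bound a quantity by a multiple of the entropy weight, it suffices to use a single exponent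
at a time. -/
lemma le_mul_entropyWeight (hψ : IsGeneratingFunction ψ a b) {A δ N : ℝ≥0∞} (hN : 1 ≤ N)
    (hδ : δ ≠ 0) (h : ∀ q ∈ expInterval a b, A ≤ δ * (N ^ (1 / q) * ENNReal.ofReal (ψ q))) :
    A ≤ δ * entropyWeight ψ a b N := by
  -- The factor e² coming from the 2 in the entropy integral is pure slack here.
  have hE : N ≤ EReal.exp 2 * N := le_mul_of_one_le_left' one_le_exp_two
  have key : ∀ B : ℝ≥0∞,
      (∀ q ∈ expInterval a b, B ≤ N ^ (1 / q) * ENNReal.ofReal (ψ q)) →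
        B ≤ entropyWeight ψ a b N := by
    intro B hB
    rw [entropyWeight_eq]
    refine le_iInf₂ fun y hy => ?_
    rcases exp_logGen y hψ with h' | ⟨-, h2, h'⟩
    · rw [h', ENNReal.mul_top]
      · exact le_top
      · exact (lt_of_lt_of_le zero_lt_one (one_le_ennreal_rpow hy (hN.trans hE))).ne'
    · rw [h']
      refine (hB _ h2).trans ?_
      rw [one_div_one_div]
      gcongr
  rcases eq_or_ne δ ⊤ with rfl | hδt
  · rw [ENNReal.top_mul]
    · exact le_top
    · refine (lt_of_lt_of_le zero_lt_one (key 1 fun q hq => ?_)).ne'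
      have hq0 : 0 < q := by linarith [hψ.one_le_left, hq.1]
      refine one_le_mul (one_le_ennreal_rpow (by positivity) hN) ?_
      simpa using hψ.one_le q hq
  · rw [← ENNReal.div_le_iff' hδ hδt]
    refine key _ fun q hq => ?_
    rw [ENNReal.div_le_iff' hδ hδt]
    exact h q hq

lemma one_le_entropyWeight (hψ : IsGeneratingFunction ψ a b) {N : ℝ≥0∞} (hN : 1 ≤ N) :
    1 ≤ entropyWeight ψ a b N := by
  have := le_mul_entropyWeight hψ hN one_ne_zero (A := 1) fun q hq => by
    have hq0 : 0 < q := by linarith [hψ.one_le_left, hq.1]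
    rw [one_mul]
    refine one_le_mul (one_le_ennreal_rpow (by positivity) hN) ?_
    simpa using hψ.one_le q hq
  simpa using this

lemma entropyWeight_top (hψ : IsGeneratingFunction ψ a b) : entropyWeight ψ a b ⊤ = ⊤ := by
  rw [eq_top_iff, ← one_mul (entropyWeight ψ a b ⊤)]
  refine le_mul_entropyWeight hψ le_top one_ne_zero fun q hq => ?_
  have hq0 : 0 < q := by linarith [hψ.one_le_left, hq.1]
  rw [ENNReal.top_rpow_of_pos (by positivity), ENNReal.top_mul, one_mul]
  have := hψ.one_le q hq
  simpa using (by linarith : 0 < ψ q)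

lemma IsGeneratingFunction.exists_mem (hψ : IsGeneratingFunction ψ a b) :
    ∃ p, p ∈ expInterval a b := by
  obtain ⟨p, h1, h2⟩ := EReal.lt_iff_exists_real_btwn.1 hψ.left_lt_right
  exact ⟨p, by exact_mod_cast h1, h2⟩

lemma IsGeneratingFunction.one_lt (hψ : IsGeneratingFunction ψ a b) {p : ℝ}
    (hp : p ∈ expInterval a b) : 1 < p :=
  lt_of_le_of_lt hψ.one_le_left hp.1

lemma IsGeneratingFunction.one_le_ofReal (hψ : IsGeneratingFunction ψ a b) {p : ℝ}
    (hp : p ∈ expInterval a b) : 1 ≤ ENNReal.ofReal (ψ p) := by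
  simpa using hψ.one_le p hp

end Weight

/-! ### Covering numbers. -/

section Entropy

variable {X : Type*} {d : X → X → ℝ≥0∞}

lemma entropyNumber_anti : Antitone (entropyNumber d) := by
  intro ε ε' h
  refine le_iInf₂ fun C hC => iInf₂_le C fun x => ?_
  obtain ⟨c, hc, hcx⟩ := hC x
  exact ⟨c, hc, hcx.trans (ENNReal.ofReal_le_ofReal h)⟩

lemma one_le_entropyNumber [Nonempty X] (ε : ℝ) : 1 ≤ entropyNumber d ε := by
  refine le_iInf₂ fun C hC => ?_
  obtain ⟨c, hc, -⟩ := hC (Classical.arbitrary X)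
  exact Set.one_le_encard_iff_nonempty.2 ⟨c, hc⟩

lemma exists_finset_net {ε : ℝ} (h : entropyNumber d ε ≠ ⊤) :
    ∃ C : Finset X, (∀ x, ∃ c ∈ C, d c x ≤ ENNReal.ofReal ε) ∧
      (C.card : ℕ∞) ≤ entropyNumber d ε := by
  -- A finite infimum of extended naturals is attained: a cover with fewer than N + 1 centres has at
  -- most N.
  have h1 : entropyNumber d ε < entropyNumber d ε + 1 := by
    rw [ENat.lt_add_one_iff h]
  conv_lhs at h1 => rw [entropyNumber]
  obtain ⟨C, h2⟩ := iInf_lt_iff.1 h1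
  obtain ⟨hC, h3⟩ := iInf_lt_iff.1 h2
  rw [ENat.lt_add_one_iff h] at h3
  have hfin : C.Finite := Set.encard_ne_top_iff.1 (ne_top_of_le_ne_top h h3)
  refine ⟨hfin.toFinset, by simpa using hC, ?_⟩
  rwa [← Set.encard_coe_eq_coe_finsetCard, hfin.coe_toFinset]

end Entropy

/-! ### The Gψ norm: maxima, sums and series. -/

section GPsi

variable {ψ : ℝ → ℝ} {a : ℝ} {b : EReal} {Ω : Type*} [MeasurableSpace Ω] {P : Measure Ω}

lemma gpsiNorm_le_iff (hψ : IsGeneratingFunction ψ a b) {E : Type*} [ENorm E] {η : Ω → E}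
    {M : ℝ≥0∞} :
    gpsiNorm ψ a b P η ≤ M ↔
      ∀ p ∈ expInterval a b, eLpNorm η (ENNReal.ofReal p) P ≤ M * ENNReal.ofReal (ψ p) := by
  rw [gpsiNorm, iSup₂_le_iff]
  refine forall₂_congr fun p hp => ?_
  rw [ENNReal.div_le_iff_le_mul]
  · exact Or.inl (lt_of_lt_of_le zero_lt_one (hψ.one_le_ofReal hp)).ne'
  · exact Or.inl ENNReal.ofReal_ne_top

lemma eLpNorm_le_of_gpsiNorm_le (hψ : IsGeneratingFunction ψ a b) {E : Type*} [ENorm E]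
    {η : Ω → E} {M : ℝ≥0∞} (h : gpsiNorm ψ a b P η ≤ M) {p : ℝ} (hp : p ∈ expInterval a b) :
    eLpNorm η (ENNReal.ofReal p) P ≤ M * ENNReal.ofReal (ψ p) :=
  (gpsiNorm_le_iff hψ).1 h p hp

lemma eLpNorm_eq_rpow {E : Type*} [ENorm E] {p : ℝ} (hp : 0 < p) (η : Ω → E) :
    eLpNorm η (ENNReal.ofReal p) P = (∫⁻ ω, ‖η ω‖ₑ ^ p ∂P) ^ (1 / p) := by
  rw [eLpNorm_eq_lintegral_rpow_enorm_toReal (by simpa using hp) ENNReal.ofReal_ne_top,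
    ENNReal.toReal_ofReal hp.le]

/-- The p-th power of a maximum is at most the sum of the p-th powers. -/
lemma eLpNorm_iSup_finset_le {ι : Type*} (s : Finset ι) {V : ι → Ω → ℝ≥0∞}
    (hV : ∀ i ∈ s, AEMeasurable (V i) P) {p : ℝ} (hp : 0 < p) {K : ℝ≥0∞}
    (h : ∀ i ∈ s, eLpNorm (V i) (ENNReal.ofReal p) P ≤ K) :
    eLpNorm (fun ω => ⨆ i ∈ s, V i ω) (ENNReal.ofReal p) P ≤ (s.card : ℝ≥0∞) ^ (1 / p) * K := by
  rw [eLpNorm_eq_rpow hp]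
  have h1 : ∫⁻ ω, ‖⨆ i ∈ s, V i ω‖ₑ ^ p ∂P ≤ s.card * K ^ p := by
    calc ∫⁻ ω, ‖⨆ i ∈ s, V i ω‖ₑ ^ p ∂P ≤ ∫⁻ ω, ∑ i ∈ s, V i ω ^ p ∂P := by
          refine lintegral_mono fun ω => ?_
          simp only [enorm_eq_self]
          rw [← ENNReal.orderIsoRpow_apply p hp, OrderIso.map_iSup]
          refine iSup_le fun i => ?_
          rw [OrderIso.map_iSup]
          refine iSup_le fun hi => ?_
          rw [ENNReal.orderIsoRpow_apply]
          exact Finset.single_le_sum (f := fun i => V i ω ^ p) (fun _ _ => zero_le) hi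
      _ = ∑ i ∈ s, ∫⁻ ω, V i ω ^ p ∂P :=
          lintegral_finsetSum' _ fun i hi => (hV i hi).pow_const p
      _ ≤ ∑ i ∈ s, K ^ p := by
          refine Finset.sum_le_sum fun i hi => ?_
          have := h i hi
          rw [eLpNorm_eq_rpow hp, one_div, ENNReal.rpow_inv_le_iff hp] at this
          simpa using this
      _ = s.card * K ^ p := by simp
  calc _ ≤ (s.card * K ^ p) ^ (1 / p) := by gcongr
    _ = _ := by
      rw [ENNReal.mul_rpow_of_nonneg _ _ (by positivity), ← ENNReal.rpow_mul,
        mul_one_div_cancel hp.ne', ENNReal.rpow_one]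

/-- The maximum of `N` random variables costs at most the entropy weight of `N`. -/
lemma gpsiNorm_iSup_finset_le [IsProbabilityMeasure P] (hψ : IsGeneratingFunction ψ a b)
    {ι : Type*} (s : Finset ι) (hs : s.Nonempty) {V : ι → Ω → ℝ≥0∞}
    (hV : ∀ i ∈ s, AEMeasurable (V i) P) {δ : ℝ≥0∞} (hδ : δ ≠ 0)
    (h : ∀ i ∈ s, gpsiNorm ψ a b P (V i) ≤ δ) :
    gpsiNorm ψ a b P (fun ω => ⨆ i ∈ s, V i ω) ≤ δ * entropyWeight ψ a b s.card := by
  have hN : (1 : ℝ≥0∞) ≤ s.card := by exact_mod_cast hs.card_pos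
  have hmeas : AEMeasurable (fun ω => ⨆ i ∈ s, V i ω) P :=
    AEMeasurable.biSup (s : Set ι) s.countable_toSet (fun i hi => hV i hi)
  refine iSup₂_le fun p hp => le_mul_entropyWeight hψ hN hδ fun q hq => ?_
  have hp0 : 0 < p := zero_lt_one.trans (hψ.one_lt hp)
  have hq0 : 0 < q := zero_lt_one.trans (hψ.one_lt hq)
  have hψp := hψ.one_le_ofReal hp
  rw [ENNReal.div_le_iff_le_mul (Or.inl (zero_lt_one.trans_le hψp).ne')
    (Or.inl ENNReal.ofReal_ne_top)]
  -- The exponent p tests the norm and q comes from the weight. If p ≤ q, the L^p norm is at most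
  -- the L^q norm on a probability space, and dividing by ψ(p) ≥ 1 costs nothing. If q ≤ p, then
  -- N^{1/p} ≤ N^{1/q} because N ≥ 1, and the missing factor ψ(q) is at least 1.
  rcases le_total p q with hpq | hqp
  · calc _ ≤ eLpNorm (fun ω => ⨆ i ∈ s, V i ω) (ENNReal.ofReal q) P :=
          eLpNorm_le_eLpNorm_of_exponent_le (ENNReal.ofReal_le_ofReal hpq)
            hmeas.aestronglyMeasurable
      _ ≤ (s.card : ℝ≥0∞) ^ (1 / q) * (δ * ENNReal.ofReal (ψ q)) :=
          eLpNorm_iSup_finset_le s hV hq0 fun i hi => eLpNorm_le_of_gpsiNorm_le hψ (h i hi) hq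
      _ = δ * ((s.card : ℝ≥0∞) ^ (1 / q) * ENNReal.ofReal (ψ q)) * 1 := by ring
      _ ≤ _ := by gcongr
  · calc _ ≤ (s.card : ℝ≥0∞) ^ (1 / p) * (δ * ENNReal.ofReal (ψ p)) :=
          eLpNorm_iSup_finset_le s hV hp0 fun i hi => eLpNorm_le_of_gpsiNorm_le hψ (h i hi) hp
      _ ≤ (s.card : ℝ≥0∞) ^ (1 / q) * (δ * ENNReal.ofReal (ψ p)) := by
          gcongr
      _ = δ * ((s.card : ℝ≥0∞) ^ (1 / q) * 1) * ENNReal.ofReal (ψ p) := by ring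
      _ ≤ _ := by
          gcongr
          exact hψ.one_le_ofReal hq

lemma gpsiNorm_mono_ae (hψ : IsGeneratingFunction ψ a b) {E F : Type*} [ENorm E] [ENorm F]
    {η : Ω → E} {ζ : Ω → F} (h : ∀ᵐ ω ∂P, ‖η ω‖ₑ ≤ ‖ζ ω‖ₑ) :
    gpsiNorm ψ a b P η ≤ gpsiNorm ψ a b P ζ := by
  rw [gpsiNorm_le_iff hψ]
  intro p hp
  have hp0 : 0 < p := zero_lt_one.trans (hψ.one_lt hp)
  refine le_trans ?_ (eLpNorm_le_of_gpsiNorm_le hψ le_rfl hp)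
  rw [eLpNorm_eq_rpow hp0, eLpNorm_eq_rpow hp0]
  refine ENNReal.rpow_le_rpow (lintegral_mono_ae ?_) (by positivity)
  filter_upwards [h] with ω hω
  gcongr

lemma gpsiNorm_enorm (η : Ω → ℝ≥0∞) {E : Type*} [ENorm E] (ζ : Ω → E)
    (h : ∀ ω, η ω = ‖ζ ω‖ₑ) (hψ : IsGeneratingFunction ψ a b) :
    gpsiNorm ψ a b P η = gpsiNorm ψ a b P ζ :=
  le_antisymm (gpsiNorm_mono_ae hψ (by simp [h])) (gpsiNorm_mono_ae hψ (by simp [h]))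

lemma gpsiNorm_add_le (hψ : IsGeneratingFunction ψ a b) {η ζ : Ω → ℝ≥0∞}
    (hη : AEMeasurable η P) (hζ : AEMeasurable ζ P) :
    gpsiNorm ψ a b P (fun ω => η ω + ζ ω) ≤ gpsiNorm ψ a b P η + gpsiNorm ψ a b P ζ := by
  rw [gpsiNorm_le_iff hψ]
  intro p hp
  have h1 := hψ.one_lt hp
  have := eLpNorm_add_le hη.aestronglyMeasurable hζ.aestronglyMeasurable
    (p := ENNReal.ofReal p) (μ := P) (by simpa using h1.le)
  rw [add_mul]
  exact this.trans (add_le_add (eLpNorm_le_of_gpsiNorm_le hψ le_rfl hp)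
    (eLpNorm_le_of_gpsiNorm_le hψ le_rfl hp))

lemma gpsiNorm_sum_le (hψ : IsGeneratingFunction ψ a b) {η : ℕ → Ω → ℝ≥0∞}
    (hη : ∀ n, AEMeasurable (η n) P) (n : ℕ) :
    gpsiNorm ψ a b P (fun ω => ∑ i ∈ Finset.range n, η i ω) ≤
      ∑ i ∈ Finset.range n, gpsiNorm ψ a b P (η i) := by
  induction n with
  | zero =>
    rw [gpsiNorm_le_iff hψ]
    intro p hp
    have h1 := hψ.one_lt hp
    simp [eLpNorm_eq_rpow (zero_lt_one.trans h1), zero_lt_one.trans h1]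
  | succ n ih =>
    simp only [Finset.sum_range_succ]
    refine (gpsiNorm_add_le hψ ?_ (hη n)).trans (by gcongr)
    exact Finset.aemeasurable_fun_sum _ fun i _ => hη i

lemma gpsiNorm_tsum_le (hψ : IsGeneratingFunction ψ a b) {η : ℕ → Ω → ℝ≥0∞}
    (hη : ∀ n, AEMeasurable (η n) P) :
    gpsiNorm ψ a b P (fun ω => ∑' i, η i ω) ≤ ∑' i, gpsiNorm ψ a b P (η i) := by
  rw [gpsiNorm_le_iff hψ]
  intro p hp
  have hp0 : 0 < p := zero_lt_one.trans (hψ.one_lt hp)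
  rw [eLpNorm_eq_rpow hp0, one_div, ENNReal.rpow_inv_le_iff hp0]
  have hmono : ∀ ω, Monotone fun n => (∑ i ∈ Finset.range n, η i ω) ^ p := fun ω m n hmn =>
    ENNReal.rpow_le_rpow (Finset.sum_le_sum_of_subset (Finset.range_mono hmn)) hp0.le
  have hpt : ∀ ω, ‖∑' i, η i ω‖ₑ ^ p = ⨆ n, (∑ i ∈ Finset.range n, η i ω) ^ p := by
    intro ω
    rw [enorm_eq_self, ENNReal.tsum_eq_iSup_nat, ← ENNReal.orderIsoRpow_apply p hp0,
      OrderIso.map_iSup]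
    rfl
  simp only [hpt]
  rw [lintegral_iSup' (fun n => (Finset.aemeasurable_fun_sum _ fun i _ => hη i).pow_const p)
    (Filter.Eventually.of_forall hmono)]
  refine iSup_le fun n => ?_
  have := eLpNorm_le_of_gpsiNorm_le hψ ((gpsiNorm_sum_le hψ hη n).trans
    (ENNReal.sum_le_tsum _)) hp
  rw [eLpNorm_eq_rpow hp0, one_div, ENNReal.rpow_inv_le_iff hp0] at this
  simpa using this

end GPsi

/-! ### Chaining and the entropy integral. -/

section Chaining

variable {ψ : ℝ → ℝ} {a : ℝ} {b : EReal} {Ω : Type*} [MeasurableSpace Ω] {P : Measure Ω}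
  {𝕜 : Type*} [RCLike 𝕜] {X : Type*}

/-- Chaining along a sequence of finite nets. -/
lemma exists_majorant_of_nets [IsProbabilityMeasure P] [Nonempty X]
    (hψ : IsGeneratingFunction ψ a b) {Y : X → Ω → 𝕜}
    (hY : ∀ x, AEStronglyMeasurable (Y x) P) {C : ℕ → Finset X} {ε : ℕ → ℝ≥0∞}
    (hε0 : ∀ k, ε k ≠ 0) (hε : Filter.Tendsto ε Filter.atTop (nhds 0))
    (hC : ∀ k x, ∃ c ∈ C k, naturalDist ψ a b P Y c x ≤ ε k) {M : ℝ≥0∞} (hM0 : M ≠ 0)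
    (hM : ∀ x, gpsiNorm ψ a b P (Y x) ≤ M) :
    ∃ Z : Ω → ℝ≥0∞, AEMeasurable Z P ∧ (∀ x, ∀ᵐ ω ∂P, ‖Y x ω‖ₑ ≤ Z ω) ∧
      gpsiNorm ψ a b P Z ≤ M * entropyWeight ψ a b (C 0).card +
        ∑' k, ε k * entropyWeight ψ a b (C (k + 1)).card := by
  choose π hπC hπ using hC
  have hne : ∀ k, (C k).Nonempty := fun k => ⟨_, hπC k (Classical.arbitrary X)⟩
  set W₀ : Ω → ℝ≥0∞ := fun ω => ⨆ c ∈ C 0, ‖Y c ω‖ₑ with hW₀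
  -- Each link joins a point of the net k + 1 to its neighbour in the coarser net k, so it has size
  -- at most ε k while the maximum runs over the finer net.
  set W : ℕ → Ω → ℝ≥0∞ := fun k ω => ⨆ c ∈ C (k + 1), ‖Y (π k c) ω - Y c ω‖ₑ with hW
  have hW₀m : AEMeasurable W₀ P :=
    AEMeasurable.biSup (C 0 : Set X) (C 0).countable_toSet fun c _ => (hY c).enorm
  have hWm : ∀ k, AEMeasurable (W k) P := fun k =>
    AEMeasurable.biSup (C (k + 1) : Set X) (C (k + 1)).countable_toSet
      fun c _ => ((hY _).sub (hY c)).enorm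
  have hZm : AEMeasurable (fun ω => W₀ ω + ∑' k, W k ω) P :=
    hW₀m.add (AEMeasurable.tsum hWm)
  have hnet : ∀ K, ∀ c ∈ C K, ∀ ω, ‖Y c ω‖ₑ ≤ W₀ ω + ∑ k ∈ Finset.range K, W k ω := by
    intro K
    induction K with
    | zero =>
      intro c hc ω
      simpa using le_iSup₂_of_le (f := fun c (_ : c ∈ C 0) => ‖Y c ω‖ₑ) c hc le_rfl
    | succ K ih =>
      intro c hc ω
      rw [Finset.sum_range_succ, ← add_assoc]
      calc ‖Y c ω‖ₑ = ‖Y (π K c) ω - (Y (π K c) ω - Y c ω)‖ₑ := by congr 1; ring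
        _ ≤ ‖Y (π K c) ω‖ₑ + ‖Y (π K c) ω - Y c ω‖ₑ := enorm_sub_le
        _ ≤ _ := add_le_add (ih _ (hπC K c) ω)
          (le_iSup₂_of_le (f := fun c (_ : c ∈ C (K + 1)) => ‖Y (π K c) ω - Y c ω‖ₑ)
            c hc le_rfl)
  refine ⟨fun ω => W₀ ω + ∑' k, W k ω, hZm, fun x => ?_, ?_⟩
  · obtain ⟨p, hp⟩ := hψ.exists_mem
    have hp1 := hψ.one_lt hp
    -- The mean excess of |Y x| over Z is at most the mean distance to the nearest net point, which
    -- tends to 0; no path regularity is needed.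
    have hle : ∀ K, ∫⁻ ω, (‖Y x ω‖ₑ - (W₀ ω + ∑' k, W k ω)) ∂P ≤
        ε K * ENNReal.ofReal (ψ p) := by
      intro K
      calc ∫⁻ ω, (‖Y x ω‖ₑ - (W₀ ω + ∑' k, W k ω)) ∂P
          ≤ ∫⁻ ω, ‖Y (π K x) ω - Y x ω‖ₑ ∂P := by
            refine lintegral_mono fun ω => ?_
            rw [tsub_le_iff_left]
            calc ‖Y x ω‖ₑ = ‖Y (π K x) ω - (Y (π K x) ω - Y x ω)‖ₑ := by congr 1; ring
              _ ≤ ‖Y (π K x) ω‖ₑ + ‖Y (π K x) ω - Y x ω‖ₑ := enorm_sub_le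
              _ ≤ _ := by
                gcongr
                refine (hnet K _ (hπC K x) ω).trans ?_
                gcongr
                exact ENNReal.sum_le_tsum _
        _ = eLpNorm (fun ω => Y (π K x) ω - Y x ω) 1 P := eLpNorm_one_eq_lintegral_enorm.symm
        _ ≤ eLpNorm (fun ω => Y (π K x) ω - Y x ω) (ENNReal.ofReal p) P :=
            eLpNorm_le_eLpNorm_of_exponent_le (by simpa using hp1.le) ((hY _).sub (hY x))
        _ ≤ _ := eLpNorm_le_of_gpsiNorm_le hψ (hπ K x) hp
    have hlim : Filter.Tendsto (fun K => ε K * ENNReal.ofReal (ψ p)) Filter.atTop (nhds 0) := by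
      simpa using ENNReal.Tendsto.mul_const hε (Or.inr ENNReal.ofReal_ne_top)
    have h0 : ∫⁻ ω, (‖Y x ω‖ₑ - (W₀ ω + ∑' k, W k ω)) ∂P = 0 :=
      le_antisymm (ge_of_tendsto' hlim hle) zero_le
    filter_upwards [(lintegral_eq_zero_iff' ((hY x).enorm.sub hZm)).1 h0] with ω hω
    exact tsub_eq_zero_iff_le.1 hω
  · refine (gpsiNorm_add_le hψ hW₀m (AEMeasurable.tsum hWm)).trans (add_le_add ?_ ?_)
    · refine gpsiNorm_iSup_finset_le hψ _ (hne 0) (fun c _ => (hY c).enorm) hM0 fun c _ => ?_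
      rw [gpsiNorm_enorm _ (Y c) (fun _ => rfl) hψ]
      exact hM c
    · refine (gpsiNorm_tsum_le hψ hWm).trans (ENNReal.tsum_le_tsum fun k => ?_)
      refine gpsiNorm_iSup_finset_le hψ _ (hne _) (fun c _ => ((hY _).sub (hY c)).enorm)
        (hε0 k) fun c _ => ?_
      exact (gpsiNorm_enorm _ (fun ω => Y (π k c) ω - Y c ω) (fun _ => rfl) hψ).trans_le (hπ k c)

/-- The dyadic sums of an entropy integral. -/
lemma tsum_entropyWeight_le {d : X → X → ℝ≥0∞} {D : ℝ} (hD : 0 < D) :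
    ∑' k : ℕ, ENNReal.ofReal (D / 2 ^ (k + 1)) *
        entropyWeight ψ a b (entropyNumber d (D / 2 ^ (k + 1)) : ℕ∞) ≤
      2 * entropyIntegral ψ a b (ENNReal.ofReal D) d := by
  set r : ℕ → ℝ := fun k => D / 2 ^ (k + 1) with hr
  set h : ℝ → ℝ≥0∞ := fun ε => entropyWeight ψ a b (entropyNumber d ε : ℕ∞) with hh
  have hanti : Antitone r := by
    refine antitone_nat_of_succ_le fun k => ?_
    simp only [hr]
    gcongr
    · norm_num
    · omega
  have hsub : (⋃ k, Ioc (r (k + 1)) (r k)) ⊆ {ε : ℝ | 0 < ε ∧ ENNReal.ofReal ε ≤ .ofReal D} := by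
    refine iUnion_subset fun k ε hε => ⟨lt_trans (by positivity) hε.1,
      ENNReal.ofReal_le_ofReal (hε.2.trans ?_)⟩
    exact div_le_self hD.le (one_le_pow₀ (by norm_num))
  have h1 : ∑' k, ∫⁻ ε in Ioc (r (k + 1)) (r k), h ε ≤
      entropyIntegral ψ a b (ENNReal.ofReal D) d := by
    have hdisj : Pairwise (Function.onFun Disjoint fun k => Ioc (r (k + 1)) (r k)) :=
      hanti.pairwise_disjoint_on_Ioc_succ
    rw [← lintegral_iUnion (fun _ => measurableSet_Ioc) hdisj]
    exact lintegral_mono_set hsub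
  refine le_trans ?_ (mul_le_mul_right h1 2)
  rw [← ENNReal.tsum_mul_left]
  refine ENNReal.tsum_le_tsum fun k => ?_
  -- Each radius is twice the length of the dyadic interval below it, on which the weight is at
  -- least its value at the right end.
  have h2 : ENNReal.ofReal (r k) = 2 * ENNReal.ofReal (r k - r (k + 1)) := by
    rw [← ENNReal.ofReal_ofNat 2, ← ENNReal.ofReal_mul (by norm_num)]
    congr 1
    simp only [hr]
    field_simp
    ring
  rw [h2, mul_assoc]
  gcongr
  calc ENNReal.ofReal (r k - r (k + 1)) * h (r k) = ∫⁻ _ in Ioc (r (k + 1)) (r k), h (r k) := by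
        rw [setLIntegral_const, Real.volume_Ioc, mul_comm]
    _ ≤ ∫⁻ ε in Ioc (r (k + 1)) (r k), h ε := by
        refine setLIntegral_mono' measurableSet_Ioc fun ε hε => entropyWeight_mono ?_
        exact_mod_cast entropyNumber_anti hε.2

/-- A random field with finite entropy integral is dominated by a random variable, with a bound for
its `Gψ` norm. -/
lemma exists_majorant_of_entropyIntegral [IsProbabilityMeasure P] [Nonempty X]
    (hψ : IsGeneratingFunction ψ a b) {Y : X → Ω → 𝕜}
    (hY : ∀ x, AEStronglyMeasurable (Y x) P) {D : ℝ} (hD : 0 < D)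
    (hI : entropyIntegral ψ a b (ENNReal.ofReal D) (naturalDist ψ a b P Y) < ∞)
    {M : ℝ≥0∞} (hM1 : 1 ≤ M) (hM : ∀ x, gpsiNorm ψ a b P (Y x) ≤ M * ENNReal.ofReal D) :
    ∃ Z : Ω → ℝ≥0∞, AEMeasurable Z P ∧ (∀ x, ∀ᵐ ω ∂P, ‖Y x ω‖ₑ ≤ Z ω) ∧
      gpsiNorm ψ a b P Z ≤
        4 * M * entropyIntegral ψ a b (ENNReal.ofReal D) (naturalDist ψ a b P Y) := by
  set d := naturalDist ψ a b P Y with hd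
  set r : ℕ → ℝ := fun k => D / 2 ^ (k + 1) with hr
  set h : ℝ → ℝ≥0∞ := fun ε => entropyWeight ψ a b (entropyNumber d ε : ℕ∞) with hh
  have hr0 : ∀ k, 0 < r k := fun k => by positivity
  have hsum : ∑' k, ENNReal.ofReal (r k) * h (r k) ≤
    2 * entropyIntegral ψ a b (ENNReal.ofReal D) d := tsum_entropyWeight_le hD
  have hfin : ∀ k, entropyNumber d (r k) ≠ ⊤ := by
    intro k hk
    have h1 : ENNReal.ofReal (r k) * h (r k) ≤ 2 * entropyIntegral ψ a b (ENNReal.ofReal D) d :=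
      (ENNReal.le_tsum k).trans hsum
    have h2 : h (r k) = ⊤ := by
      simp only [hh, hk, ENat.toENNReal_top, entropyWeight_top hψ]
    rw [h2, ENNReal.mul_top (by simpa using hr0 k), top_le_iff] at h1
    exact ENNReal.mul_ne_top (by norm_num) hI.ne h1
  choose C hC hcard using fun k => exists_finset_net (hfin k)
  have hw : ∀ k, entropyWeight ψ a b (C k).card ≤ h (r k) := fun k =>
    entropyWeight_mono (by exact_mod_cast hcard k)
  have hlim : Filter.Tendsto (fun k => ENNReal.ofReal (r k)) Filter.atTop (nhds 0) := by
    rw [← ENNReal.ofReal_zero]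
    refine ENNReal.tendsto_ofReal ?_
    refine Filter.Tendsto.const_div_atTop ?_ D
    exact (tendsto_pow_atTop_atTop_of_one_lt (by norm_num)).comp (Filter.tendsto_add_atTop_nat 1)
  obtain ⟨Z, hZm, hZ, hZn⟩ := exists_majorant_of_nets hψ hY
    (fun k => by simpa using hr0 k) hlim hC
    (mul_ne_zero (zero_lt_one.trans_le hM1).ne' (by simpa using hD)) hM
  refine ⟨Z, hZm, hZ, hZn.trans ?_⟩
  have h2r : ∀ x : ℝ, ENNReal.ofReal (2 * x) = 2 * ENNReal.ofReal x := fun x => by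
    rw [ENNReal.ofReal_mul (by norm_num), ENNReal.ofReal_ofNat]
  -- D = 2 r 0 and r k = 2 r (k + 1), so the first net and all links together form 2M times one
  -- dyadic sum; that sum is at most twice the integral, whence 4M.
  calc M * ENNReal.ofReal D * entropyWeight ψ a b (C 0).card +
        ∑' k, ENNReal.ofReal (r k) * entropyWeight ψ a b (C (k + 1)).card
      ≤ M * (2 * (ENNReal.ofReal (r 0) * h (r 0))) +
        ∑' k, M * (2 * (ENNReal.ofReal (r (k + 1)) * h (r (k + 1)))) := by
        refine add_le_add ?_ (ENNReal.tsum_le_tsum fun k => ?_)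
        · rw [mul_assoc, ← mul_assoc 2, ← h2r]
          gcongr
          · exact le_of_eq (by simp only [hr]; ring)
          · exact hw 0
        · rw [← mul_assoc 2, ← h2r]
          refine le_trans ?_ (le_mul_of_one_le_left' hM1)
          gcongr
          · exact le_of_eq (by simp only [hr]; field_simp; ring)
          · exact hw _
    _ = ∑' k, M * (2 * (ENNReal.ofReal (r k) * h (r k))) :=
        (tsum_eq_zero_add' (f := fun k => M * (2 * (ENNReal.ofReal (r k) * h (r k))))
          ENNReal.summable).symm
    _ = M * (2 * ∑' k, ENNReal.ofReal (r k) * h (r k)) := by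
        rw [ENNReal.tsum_mul_left, ENNReal.tsum_mul_left]
    _ ≤ M * (2 * (2 * entropyIntegral ψ a b (ENNReal.ofReal D) d)) := by gcongr
    _ = _ := by ring

lemma lt_top_of_entropyIntegral_lt_top [Nonempty X] (hψ : IsGeneratingFunction ψ a b) {D : ℝ≥0∞}
    {d : X → X → ℝ≥0∞} (hI : entropyIntegral ψ a b D d < ∞) : D < ∞ := by
  by_contra hD
  rw [not_lt, top_le_iff] at hD
  subst hD
  refine hI.ne (top_le_iff.1 ?_)
  calc (⊤ : ℝ≥0∞) = ∫⁻ _ in Ioi (0 : ℝ), 1 := by simp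
    _ ≤ ∫⁻ ε in Ioi (0 : ℝ), entropyWeight ψ a b (entropyNumber d ε : ℕ∞) := by
        refine lintegral_mono fun ε => one_le_entropyWeight hψ ?_
        exact_mod_cast one_le_entropyNumber ε
    _ ≤ _ := lintegral_mono_set fun ε (hε : 0 < ε) =>
        (⟨hε, le_top⟩ : 0 < ε ∧ ENNReal.ofReal ε ≤ ⊤)

end Chaining

/-! ### Extremal points, Hölder's inequality and the norm of the constant 1. -/

namespace RINorm

variable {T : Type*} [MeasurableSpace T] {μ : Measure T} (L : RINorm μ) {𝕜 : Type*} [RCLike 𝕜]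

lemma assocNorm_neg (g : T →ₘ[μ] 𝕜) : L.assocNorm (-g) = L.assocNorm g := by
  refine iSup_congr fun f => iSup_congr fun _ => iSup_congr fun _ => lintegral_congr_ae ?_
  filter_upwards [AEEqFun.coeFn_neg g] with t ht
  rw [ht, Pi.neg_apply, enorm_neg]

variable {L}

lemma neg_mem_extremalSet {g : T →ₘ[μ] 𝕜} (hg : g ∈ L.extremalSet 𝕜) :
    -g ∈ L.extremalSet 𝕜 := by
  refine ⟨by simpa [assocNorm_neg] using hg.1, fun x hx y hy hxy => ?_⟩
  have hx' : L.assocNorm (-x) ≤ 1 := by rw [assocNorm_neg]; exact hx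
  have hy' : L.assocNorm (-y) ≤ 1 := by rw [assocNorm_neg]; exact hy
  obtain ⟨s, t, hs, ht, hst, h⟩ := hxy
  have h' : g ∈ openSegment ℝ (-x) (-y) := by
    refine ⟨s, t, hs, ht, hst, ?_⟩
    rw [smul_neg, smul_neg, ← neg_add, h, neg_neg]
  rw [← hg.2 hx' hy' h', neg_neg]

/-- S is symmetric, so g and -g are two of its points, at distance ∫|2g|. The factor 2 is given
away. -/
lemma lintegral_enorm_le_extremalDiam {g : T →ₘ[μ] 𝕜} (hg : g ∈ L.extremalSet 𝕜) :
    ∫⁻ t, ‖g t‖ₑ ∂μ ≤ L.extremalDiam 𝕜 := by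
  refine le_trans ?_ (le_iSup₂_of_le g hg
    (le_iSup₂_of_le (f := fun g₂ (_ : g₂ ∈ L.extremalSet 𝕜) => ∫⁻ t, ‖g t - g₂ t‖ₑ ∂μ)
      (-g) (neg_mem_extremalSet hg) le_rfl))
  refine lintegral_mono_ae ?_
  filter_upwards [AEEqFun.coeFn_neg g] with t ht
  rw [ht, Pi.neg_apply, sub_neg_eq_add, ← two_mul, enorm_mul]
  refine le_mul_of_one_le_left' ?_
  rw [← ofReal_norm]
  simp

lemma lintegral_mul_le {g : T →ₘ[μ] 𝕜} (hg : L.assocNorm g ≤ 1) {f : T → ℝ≥0∞}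
    (hf : Measurable f) : ∫⁻ t, f t * ‖g t‖ₑ ∂μ ≤ L.toFun f := by
  rcases eq_or_ne (L.toFun f) ⊤ with htop | htop
  · rw [htop]; exact le_top
  rcases eq_or_ne (L.toFun f) 0 with h0 | h0
  · rw [h0, nonpos_iff_eq_zero, ← lintegral_zero (μ := μ)]
    refine lintegral_congr_ae ?_
    filter_upwards [(L.eq_zero_iff f hf).1 h0] with t ht
    simp [ht]
  set c := (L.toFun f).toNNReal with hc
  have hcc : (c : ℝ≥0∞) = L.toFun f := ENNReal.coe_toNNReal htop
  have hc0 : c ≠ 0 := by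
    intro h
    rw [h] at hcc
    exact h0 (by simpa using hcc.symm)
  have h1 : L.toFun (fun t => (c⁻¹ : ℝ≥0) * f t) ≤ 1 := by
    rw [L.smul _ f hf, ← hcc, ← ENNReal.coe_mul, inv_mul_cancel₀ hc0, ENNReal.coe_one]
  have h2 : ∫⁻ t, (c⁻¹ : ℝ≥0) * f t * ‖g t‖ₑ ∂μ ≤ 1 :=
    (le_iSup₂_of_le (f := fun (f : T → ℝ≥0∞) (_ : Measurable f) =>
      ⨆ (_ : L.toFun f ≤ 1), ∫⁻ t, f t * ‖g t‖ₑ ∂μ) _ (hf.const_mul _)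
      (le_iSup_of_le h1 le_rfl)).trans hg
  simp only [mul_assoc] at h2
  rw [lintegral_const_mul' _ _ ENNReal.coe_ne_top, ENNReal.coe_inv hc0, mul_comm,
    ← div_eq_mul_inv, ENNReal.div_le_iff_le_mul (by simp [hc0]) (by simp), one_mul, hcc] at h2
  exact h2

/-- The pairing of an indicator with g in S is at most ∫|g| ≤ D, so the norming property bounds
indicators of sets of finite measure; σ-finiteness and the Fatou property pass to the whole space.
-/
lemma toFun_one_le_extremalDiam [SigmaFinite μ] (hL : L.ExtremalNorming 𝕜) :
    L.toFun (fun _ => 1) ≤ L.extremalDiam 𝕜 := by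
  have hE : ∀ E, MeasurableSet E → μ E < ∞ → L.toFun (E.indicator 1) ≤ L.extremalDiam 𝕜 := by
    intro E hE hμ
    set f : T → 𝕜 := E.indicator 1 with hf
    have hfm : Measurable f := measurable_one.indicator hE
    have hfe : (fun t => ‖f t‖ₑ) = E.indicator 1 := by
      ext t
      by_cases ht : t ∈ E <;> simp [hf, ht]
    have hn : L.norm f = L.toFun (E.indicator 1) := by rw [RINorm.norm, hfe]
    rw [← hn, hL f ⟨hfm, by rw [hn]; exact L.indicator_lt_top E hE hμ⟩]
    refine iSup₂_le fun g hg => ?_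
    calc ENNReal.ofReal (RCLike.re (∫ t, f t * g t ∂μ))
        ≤ ENNReal.ofReal ‖∫ t, f t * g t ∂μ‖ := ENNReal.ofReal_le_ofReal (RCLike.re_le_norm _)
      _ = ‖∫ t, f t * g t ∂μ‖ₑ := ofReal_norm _
      _ ≤ ∫⁻ t, ‖f t * g t‖ₑ ∂μ := enorm_integral_le_lintegral_enorm _
      _ ≤ ∫⁻ t, ‖g t‖ₑ ∂μ := by
          refine lintegral_mono fun t => ?_
          by_cases ht : t ∈ E <;> simp [hf, ht]
      _ ≤ _ := lintegral_enorm_le_extremalDiam hg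
  have h1 : (fun _ : T => (1 : ℝ≥0∞)) = fun t => ⨆ n, (spanningSets μ n).indicator 1 t := by
    ext t
    refine le_antisymm ?_ (iSup_le fun n => indicator_le_self' (fun _ _ => zero_le) t)
    refine le_iSup_of_le (spanningSetsIndex μ t) ?_
    rw [indicator_of_mem (mem_spanningSetsIndex μ t)]
    rfl
  rw [h1, L.fatou _ (fun n => measurable_one.indicator (measurableSet_spanningSets μ n))
    fun m n hmn => indicator_le_indicator_of_subset (monotone_spanningSets μ hmn)
      (fun _ => zero_le)]
  exact iSup_le fun n => hE _ (measurableSet_spanningSets μ n) (measure_spanningSets_lt_top μ n)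

lemma toFun_le_of_ae_le {f : T → ℝ≥0∞} (hf : Measurable f) {c : ℝ≥0∞} (hc : c ≠ ⊤)
    (h : ∀ᵐ t ∂μ, f t ≤ c) : L.toFun f ≤ c * L.toFun fun _ => 1 := by
  lift c to ℝ≥0 using hc
  rw [← L.smul c _ measurable_const]
  refine L.mono _ _ hf (by fun_prop) ?_
  filter_upwards [h] with t ht
  simpa using ht

end RINorm

/-! ### Countable families from the separability of L¹. -/

section Separable

open Filter Topology

variable {T : Type*} [MeasurableSpace T] {μ : Measure T} {𝕜 : Type*} [RCLike 𝕜]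

lemma separableSpace_L1 [IsSeparable μ] : SecondCountableTopology (Lp 𝕜 1 μ) :=
  have : Fact ((1 : ℝ≥0∞) ≠ ∞) := ⟨ENNReal.one_ne_top⟩
  inferInstance

lemma conj_div_norm_mul_self (z : 𝕜) : (starRingEnd 𝕜 z / (‖z‖ : 𝕜)) * z = (‖z‖ : 𝕜) := by
  rcases eq_or_ne z 0 with rfl | hz
  · simp
  · have : (‖z‖ : 𝕜) ≠ 0 := by simpa using hz
    rw [div_mul_eq_mul_div, RCLike.conj_mul, sq, mul_div_assoc, div_self this, mul_one]

lemma norm_conj_div_norm_le (z : 𝕜) : ‖starRingEnd 𝕜 z / (‖z‖ : 𝕜)‖ ≤ 1 := by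
  rw [norm_div, RCLike.norm_conj, RCLike.norm_ofReal, abs_norm]
  exact div_self_le_one _

lemma measurable_conj_div_norm : Measurable fun z : 𝕜 => starRingEnd 𝕜 z / (‖z‖ : 𝕜) := by
  have h1 : Measurable fun z : 𝕜 => starRingEnd 𝕜 z := RCLike.continuous_conj.measurable
  have h2 : Measurable fun z : 𝕜 => (‖z‖ : 𝕜) :=
    (RCLike.continuous_ofReal.comp continuous_norm).measurable
  exact h1.div h2

lemma enorm_integral_norm_eq {α : Type*} [MeasurableSpace α] {ν : Measure α} {F : α → 𝕜}
    (hF : Integrable F ν) : ‖∫ x, (‖F x‖ : 𝕜) ∂ν‖ₑ = ∫⁻ x, ‖F x‖ₑ ∂ν := by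
  rw [integral_ofReal, ← ofReal_norm, RCLike.norm_ofReal,
    abs_of_nonneg (integral_nonneg fun _ => norm_nonneg _),
    ofReal_integral_eq_lintegral_ofReal hF.norm (Eventually.of_forall fun _ => norm_nonneg _)]
  simp only [ofReal_norm]

/-- Countably many functions bounded by one suffice to recover the `L¹` norm by duality. -/
lemma exists_seq_norming_L1 (μ : Measure T) [SigmaFinite μ] [IsSeparable μ] (𝕜 : Type*)
    [RCLike 𝕜] :
    ∃ h : ℕ → T → 𝕜, (∀ n, Measurable (h n)) ∧ (∀ n t, ‖h n t‖ ≤ 1) ∧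
      ∀ F : T → 𝕜, Integrable F μ → ∀ c : ℝ≥0∞,
        (∀ n, ‖∫ t, F t * h n t ∂μ‖ₑ ≤ c) → ∫⁻ t, ‖F t‖ₑ ∂μ ≤ c := by
  have : SecondCountableTopology (Lp 𝕜 1 μ) := separableSpace_L1
  set U : Set (Lp 𝕜 1 μ) := {u | ∀ᵐ t ∂μ, ‖u t‖ ≤ 1} with hU
  have : Nonempty U := by
    refine ⟨⟨0, ?_⟩⟩
    filter_upwards [Lp.coeFn_zero 𝕜 1 μ] with t ht
    rw [ht, Pi.zero_apply, norm_zero]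
    exact zero_le_one
  set q := TopologicalSpace.denseSeq U with hq
  -- Representatives are cut off so that the bound by 1 holds at every point, not just almost
  -- everywhere.
  set h : ℕ → T → 𝕜 := fun n => {t | ‖(q n : Lp 𝕜 1 μ) t‖ ≤ 1}.indicator (q n : Lp 𝕜 1 μ)
  have hqm : ∀ u : Lp 𝕜 1 μ, Measurable u := fun u => (Lp.stronglyMeasurable u).measurable
  have hm : ∀ n, Measurable (h n) := fun n =>
    (hqm _).indicator (measurableSet_le (hqm _).norm measurable_const)
  have hle : ∀ n t, ‖h n t‖ ≤ 1 := by
    intro n t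
    by_cases ht : ‖(q n : Lp 𝕜 1 μ) t‖ ≤ 1
    · simp only [h]
      rwa [indicator_of_mem (by exact ht)]
    · simp only [h]
      rw [indicator_of_notMem (by exact ht)]
      simp
  have hae : ∀ n, (q n : Lp 𝕜 1 μ) =ᵐ[μ] h n := by
    intro n
    filter_upwards [(q n).2] with t ht
    simp only [h]
    rw [indicator_of_mem (by exact ht)]
  refine ⟨h, hm, hle, fun F hF c hc => ?_⟩
  have key : ∀ m, ∫⁻ t in spanningSets μ m, ‖F t‖ₑ ∂μ ≤ c := by
    intro m
    set E := spanningSets μ m with hE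
    have hEm : MeasurableSet E := measurableSet_spanningSets μ m
    -- The conjugate phase of F turns the pairing into ∫|F|; restricting it to a set of finite
    -- measure puts it in L¹, where the dense sequence approximates it.
    set σ : T → 𝕜 := fun t => starRingEnd 𝕜 (F t) / (‖F t‖ : 𝕜) with hσ
    have hσm : AEStronglyMeasurable σ μ :=
      (measurable_conj_div_norm.comp_aemeasurable hF.aemeasurable).aestronglyMeasurable
    set v : T → 𝕜 := E.indicator σ with hv
    have hvle : ∀ t, ‖v t‖ ≤ 1 := fun t =>
      (norm_indicator_le_norm_self _ _).trans (norm_conj_div_norm_le _)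
    have hvL : MemLp v 1 μ := by
      rw [memLp_one_iff_integrable, hv, integrable_indicator_iff hEm]
      exact Measure.integrableOn_of_bounded (M := 1) (measure_spanningSets_lt_top μ m).ne hσm
        (Eventually.of_forall fun t => norm_conj_div_norm_le _)
    have hvU : hvL.toLp v ∈ U := by
      filter_upwards [hvL.coeFn_toLp] with t ht
      rw [ht]; exact hvle t
    obtain ⟨w, hw, hwlim⟩ := mem_closure_iff_seq_limit.1
      ((TopologicalSpace.denseRange_denseSeq U) ⟨_, hvU⟩)
    choose k hk using hw
    have hlim : Tendsto (fun n => (w n : Lp 𝕜 1 μ)) atTop (𝓝 (hvL.toLp v)) :=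
      (continuous_subtype_val.tendsto _).comp hwlim
    -- L¹ convergence does not control pairings with an unbounded F, but an almost everywhere
    -- convergent subsequence with dominating function |F| does.
    obtain ⟨ns, -, hns⟩ := (tendstoInMeasure_of_tendsto_Lp hlim).exists_seq_tendsto_ae
    have hae' : ∀ᵐ t ∂μ, ∀ n, (w n : Lp 𝕜 1 μ) t = h (k n) t := by
      rw [ae_all_iff]
      intro n
      rw [← hk n]
      exact hae (k n)
    have hconv : Tendsto (fun i => ∫ t, F t * h (k (ns i)) t ∂μ) atTop
        (𝓝 (∫ t, F t * v t ∂μ)) := by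
      refine tendsto_integral_of_dominated_convergence (fun t => ‖F t‖)
        (fun i => hF.aestronglyMeasurable.mul (hm _).aestronglyMeasurable) hF.norm
        (fun i => Eventually.of_forall fun t => ?_) ?_
      · rw [norm_mul]
        exact mul_le_of_le_one_right (norm_nonneg _) (hle _ _)
      · filter_upwards [hns, hae', hvL.coeFn_toLp] with t h1 h2 h3
        rw [h3] at h1
        simp only [h2] at h1
        exact h1.const_mul _
    have hc' : ‖∫ t, F t * v t ∂μ‖ₑ ≤ c :=
      le_of_tendsto' ((continuous_enorm.tendsto _).comp hconv) fun i => hc _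
    have hFv : (fun t => F t * v t) = E.indicator fun t => (‖F t‖ : 𝕜) := by
      ext t
      by_cases ht : t ∈ E
      · rw [hv, indicator_of_mem ht, indicator_of_mem ht, mul_comm]
        exact conj_div_norm_mul_self _
      · rw [hv, indicator_of_notMem ht, indicator_of_notMem ht, mul_zero]
    rwa [hFv, integral_indicator hEm, enorm_integral_norm_eq hF.integrableOn] at hc'
  rw [← setLIntegral_univ, ← iUnion_spanningSets μ,
    setLIntegral_iUnion_of_directed _ (monotone_spanningSets μ).directed_le]
  exact iSup_le key

/-- The elements of a nonempty set of integrable classes can be replaced by a sequence when testing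
against bounded functions. -/
lemma exists_seq_dense_L1 [IsSeparable μ] {S : Set (T →ₘ[μ] 𝕜)} (hS : S.Nonempty)
    (hint : ∀ g ∈ S, Integrable g μ) :
    ∃ g : ℕ → T →ₘ[μ] 𝕜, (∀ n, g n ∈ S) ∧
      ∀ f : T → 𝕜, Measurable f → ∀ C : ℝ, (∀ t, ‖f t‖ ≤ C) →
        ⨆ s ∈ S, ENNReal.ofReal (RCLike.re (∫ t, f t * s t ∂μ)) =
          ⨆ n, ENNReal.ofReal (RCLike.re (∫ t, f t * g n t ∂μ)) := by
  have : SecondCountableTopology (Lp 𝕜 1 μ) := separableSpace_L1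
  set V : Set (Lp 𝕜 1 μ) := {u | (u : T →ₘ[μ] 𝕜) ∈ S} with hV
  have hmem : ∀ s ∈ S, ∃ u : V, ((u : Lp 𝕜 1 μ) : T →ₘ[μ] 𝕜) = s := by
    intro s hs
    have h1 : s ∈ Lp 𝕜 1 μ := by
      rw [Lp.mem_Lp_iff_eLpNorm_lt_top]
      exact (memLp_one_iff_integrable.2 (hint s hs)).2
    exact ⟨⟨⟨s, h1⟩, hs⟩, rfl⟩
  have : Nonempty V := by
    obtain ⟨s, hs⟩ := hS
    exact ⟨(hmem s hs).choose⟩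
  set q := TopologicalSpace.denseSeq V with hq
  refine ⟨fun n => ((q n : Lp 𝕜 1 μ) : T →ₘ[μ] 𝕜), fun n => (q n).2, fun f hf C hC => ?_⟩
  refine le_antisymm (iSup₂_le fun s hs => ?_) (iSup_le fun n =>
    le_iSup₂_of_le (f := fun s (_ : s ∈ S) => ENNReal.ofReal (RCLike.re (∫ t, f t * s t ∂μ)))
      _ (q n).2 le_rfl)
  set Φ : Lp 𝕜 1 μ → 𝕜 := fun u => ∫ t, f t * u t ∂μ with hΦ
  -- Pairing with a bounded function is Lipschitz on L¹, so its supremum over S is attained along a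
  -- dense sequence of S.
  have hcont : Continuous Φ := by
    refine LipschitzWith.continuous (K := C.toNNReal) (LipschitzWith.of_dist_le_mul fun u u' => ?_)
    have hi : ∀ u : Lp 𝕜 1 μ, Integrable (fun t => f t * u t) μ := fun u =>
      (memLp_one_iff_integrable.1 (Lp.memLp u)).bdd_mul hf.aestronglyMeasurable
        (Eventually.of_forall hC)
    have hi' : Integrable (fun t => u t - u' t) μ :=
      (memLp_one_iff_integrable.1 (Lp.memLp u)).sub (memLp_one_iff_integrable.1 (Lp.memLp u'))
    rw [dist_eq_norm, dist_eq_norm, L1.norm_eq_integral_norm, hΦ,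
      ← integral_sub (hi u) (hi u'), ← integral_const_mul]
    refine (norm_integral_le_integral_norm _).trans (integral_mono_ae ?_ ?_ ?_)
    · exact ((hi u).sub (hi u')).norm
    · exact (L1.integrable_coeFn _).norm.const_mul _
    · filter_upwards [Lp.coeFn_sub u u'] with t ht
      rw [ht, Pi.sub_apply, ← mul_sub, norm_mul]
      gcongr
      exact (hC t).trans (Real.le_coe_toNNReal C)
  obtain ⟨u, hu⟩ := hmem s hs
  set K := ⨆ n, ENNReal.ofReal (RCLike.re (Φ (q n))) with hK
  have hclosed : IsClosed {u : V | ENNReal.ofReal (RCLike.re (Φ u)) ≤ K} :=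
    isClosed_le (ENNReal.continuous_ofReal.comp (RCLike.continuous_re.comp
      (hcont.comp continuous_subtype_val))) continuous_const
  have hall : ∀ u : V, ENNReal.ofReal (RCLike.re (Φ u)) ≤ K := by
    intro u
    have : u ∈ closure (range q) := TopologicalSpace.denseRange_denseSeq V u
    refine closure_minimal ?_ hclosed this
    rintro _ ⟨n, rfl⟩
    exact le_iSup (fun n => ENNReal.ofReal (RCLike.re (Φ (q n)))) n
  have := hall u
  simp only [hΦ, hu] at this
  exact this

end Separable

/-! ### The norm of L as a countable supremum. -/

namespace RINorm

variable {T : Type*} [MeasurableSpace T] {μ : Measure T} {L : RINorm μ} {𝕜 : Type*} [RCLike 𝕜]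

lemma mem_of_bounded (h1 : L.toFun (fun _ => 1) < ∞) {f : T → 𝕜} (hf : Measurable f) {C : ℝ≥0∞}
    (hCt : C ≠ ⊤) (hC : ∀ᵐ t ∂μ, ‖f t‖ₑ ≤ C) : L.Mem f :=
  ⟨hf, (toFun_le_of_ae_le hf.enorm hCt hC).trans_lt (ENNReal.mul_lt_top hCt.lt_top h1)⟩

/-- The norm of a measurable function as a countable supremum over truncations and integrals
against extremal points. -/
lemma exists_seq_norm_eq [IsSeparable μ] (hL : L.ExtremalNorming 𝕜)
    (hD : L.extremalDiam 𝕜 < ∞) (h1 : L.toFun (fun _ => 1) < ∞)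
    (hS : (L.extremalSet 𝕜).Nonempty) :
    ∃ g : ℕ → T →ₘ[μ] 𝕜, (∀ n, g n ∈ L.extremalSet 𝕜) ∧
      ∀ f : T → 𝕜, Measurable f → L.norm f = ⨆ m : ℕ, ⨆ n, ENNReal.ofReal
        (RCLike.re (∫ t, {t | ‖f t‖ ≤ m}.indicator f t * g n t ∂μ)) := by
  obtain ⟨g, hgS, hg⟩ := exists_seq_dense_L1 hS fun g hg =>
    ⟨g.aestronglyMeasurable, (lintegral_enorm_le_extremalDiam hg).trans_lt hD⟩
  refine ⟨g, hgS, fun f hf => ?_⟩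
  set F : ℕ → T → 𝕜 := fun m => {t | ‖f t‖ ≤ m}.indicator f with hF
  have hFm : ∀ m, Measurable (F m) := fun m =>
    hf.indicator (measurableSet_le hf.norm measurable_const)
  have hFle : ∀ (m : ℕ) t, ‖F m t‖ ≤ m := by
    intro m t
    by_cases ht : ‖f t‖ ≤ m
    · simp [hF, ht]
    · simp [hF, ht]
  have hFL : ∀ m, L.Mem (F m) := fun m =>
    mem_of_bounded h1 (hFm m) (ENNReal.natCast_ne_top m) (Filter.Eventually.of_forall fun t => by
      rw [← ofReal_norm, ← ENNReal.ofReal_natCast]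
      exact ENNReal.ofReal_le_ofReal (hFle m t))
  have hmono : Monotone fun m t => ‖F m t‖ₑ := by
    intro m n hmn t
    by_cases ht : ‖f t‖ ≤ m
    · have ht' : ‖f t‖ ≤ n := ht.trans (by exact_mod_cast hmn)
      simp [hF, ht, ht']
    · simp [hF, ht]
  have hsup : (fun t => ‖f t‖ₑ) = fun t => ⨆ m, ‖F m t‖ₑ := by
    ext t
    refine le_antisymm ?_ (iSup_le fun m => enorm_indicator_le_enorm_self _ _)
    obtain ⟨m, hm⟩ := exists_nat_ge ‖f t‖
    refine le_iSup_of_le m ?_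
    simp [hF, hm]
  rw [RINorm.norm, hsup, L.fatou _ (fun m => (hFm m).enorm) hmono]
  refine iSup_congr fun m => ?_
  rw [← hg (F m) (hFm m) m (hFle m)]
  exact hL (F m) (hFL m)

end RINorm

/-! ### From majorants of the field to the norm of its paths. -/

section RandomField

open Filter

variable {ψ : ℝ → ℝ} {a : ℝ} {b : EReal} {𝕜 : Type*} [RCLike 𝕜] {T Ω : Type*} [MeasurableSpace T]
  [MeasurableSpace Ω] {μ : Measure T} {P : Measure Ω} {ξ : T → Ω → 𝕜}

lemma measurable_section_left (hξ : Measurable fun z : T × Ω => ξ z.1 z.2) (t : T) :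
    Measurable (ξ t) := hξ.comp measurable_prodMk_left

lemma measurable_section_right (hξ : Measurable fun z : T × Ω => ξ z.1 z.2) (ω : Ω) :
    Measurable fun t => ξ t ω := hξ.comp measurable_prodMk_right

lemma measurable_integral_mul [SFinite μ] (hξ : Measurable fun z : T × Ω => ξ z.1 z.2) {k : T → 𝕜}
    (hk : Measurable k) : Measurable fun ω => ∫ t, ξ t ω * k t ∂μ := by
  have h1 : StronglyMeasurable fun z : T × Ω => ξ z.1 z.2 * k z.1 :=
    (hξ.mul (hk.comp measurable_fst)).stronglyMeasurable
  exact h1.integral_prod_left'.measurable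

/-- Minkowski's integral inequality for the `Gψ` norm. -/
lemma gpsiNorm_lintegral_mul_le [SFinite μ] [SFinite P] (hψ : IsGeneratingFunction ψ a b)
    (hξ : Measurable fun z : T × Ω => ξ z.1 z.2) (hsup : ∀ t, gpsiNorm ψ a b P (ξ t) ≤ 1)
    {k : T → ℝ≥0∞} (hk : Measurable k) :
    gpsiNorm ψ a b P (fun ω => ∫⁻ t, k t * ‖ξ t ω‖ₑ ∂μ) ≤ ∫⁻ t, k t ∂μ := by
  set K := ∫⁻ t, k t ∂μ with hK
  rcases eq_or_ne K ⊤ with htop | htop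
  · rw [htop]; exact le_top
  rw [gpsiNorm_le_iff hψ]
  intro p hp
  have hp1 := hψ.one_lt hp
  have hp0 : 0 < p := zero_lt_one.trans hp1
  -- Under the weighted measure, of mass K, Hölder's inequality bounds the p-th power of the
  -- integral by K^(p-1) times the integral of the p-th power; Tonelli then finishes.
  set ν := μ.withDensity k with hν
  have hνK : ν univ = K := by rw [hν, withDensity_apply _ MeasurableSet.univ, setLIntegral_univ]
  have hsw : ∫⁻ ω, ∫⁻ t, ‖ξ t ω‖ₑ ^ p ∂ν ∂P ≤ ENNReal.ofReal (ψ p) ^ p * K := by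
    rw [lintegral_lintegral_swap ((hξ.comp measurable_swap).enorm.pow_const p).aemeasurable]
    calc ∫⁻ t, ∫⁻ ω, ‖ξ t ω‖ₑ ^ p ∂P ∂ν ≤ ∫⁻ _, ENNReal.ofReal (ψ p) ^ p ∂ν := by
          refine lintegral_mono fun t => ?_
          have := eLpNorm_le_of_gpsiNorm_le hψ (hsup t) hp
          rwa [one_mul, eLpNorm_eq_rpow hp0, one_div, ENNReal.rpow_inv_le_iff hp0] at this
      _ = _ := by rw [lintegral_const, hνK]
  have hpt : ∀ ω, (∫⁻ t, k t * ‖ξ t ω‖ₑ ∂μ) ^ p ≤ (∫⁻ t, ‖ξ t ω‖ₑ ^ p ∂ν) * K ^ (p - 1) := by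
    intro ω
    have hm := measurable_section_right hξ ω
    have h1 : ∫⁻ t, k t * ‖ξ t ω‖ₑ ∂μ = eLpNorm (fun t => ξ t ω) 1 ν := by
      rw [eLpNorm_one_eq_lintegral_enorm, hν, lintegral_withDensity_eq_lintegral_mul _ hk hm.enorm]
      rfl
    have h2 := eLpNorm_le_eLpNorm_mul_rpow_measure_univ (μ := ν) (p := 1) (q := ENNReal.ofReal p)
      (by simpa using hp1.le) hm.aestronglyMeasurable
    rw [← h1, eLpNorm_eq_rpow hp0, hνK, ENNReal.toReal_ofReal hp0.le, ENNReal.toReal_one] at h2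
    calc _ ≤ ((∫⁻ t, ‖ξ t ω‖ₑ ^ p ∂ν) ^ (1 / p) * K ^ (1 / 1 - 1 / p)) ^ p := by gcongr
      _ = _ := by
        rw [ENNReal.mul_rpow_of_nonneg _ _ hp0.le, ← ENNReal.rpow_mul, ← ENNReal.rpow_mul,
          one_div_mul_cancel hp0.ne', ENNReal.rpow_one]
        congr 2
        field_simp
  rw [eLpNorm_eq_rpow hp0, one_div, ENNReal.rpow_inv_le_iff hp0]
  simp only [enorm_eq_self]
  calc _ ≤ ∫⁻ ω, (∫⁻ t, ‖ξ t ω‖ₑ ^ p ∂ν) * K ^ (p - 1) ∂P := lintegral_mono hpt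
    _ = (∫⁻ ω, ∫⁻ t, ‖ξ t ω‖ₑ ^ p ∂ν ∂P) * K ^ (p - 1) :=
        lintegral_mul_const' _ _ (ENNReal.rpow_ne_top_of_nonneg (by linarith) htop)
    _ ≤ ENNReal.ofReal (ψ p) ^ p * K * K ^ (p - 1) := by gcongr
    _ = _ := by
      rw [ENNReal.mul_rpow_of_nonneg _ _ hp0.le, mul_assoc, mul_comm]
      congr 1
      nth_rewrite 1 [← ENNReal.rpow_one K]
      rw [← ENNReal.rpow_add_of_nonneg _ _ zero_le_one (by linarith)]
      congr 1
      ring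

lemma gpsiNorm_integral_mul_le [SFinite μ] [SFinite P] (hψ : IsGeneratingFunction ψ a b)
    (hξ : Measurable fun z : T × Ω => ξ z.1 z.2) (hsup : ∀ t, gpsiNorm ψ a b P (ξ t) ≤ 1)
    {k : T → 𝕜} (hk : Measurable k) :
    gpsiNorm ψ a b P (fun ω => ∫ t, ξ t ω * k t ∂μ) ≤ ∫⁻ t, ‖k t‖ₑ ∂μ := by
  refine le_trans (gpsiNorm_mono_ae hψ (Eventually.of_forall fun ω => ?_))
    (gpsiNorm_lintegral_mul_le hψ hξ hsup hk.enorm)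
  rw [enorm_eq_self]
  refine (enorm_integral_le_lintegral_enorm _).trans (le_of_eq ?_)
  simp only [enorm_mul, mul_comm]

lemma lintegral_le_of_gpsiNorm_le [IsProbabilityMeasure P] (hψ : IsGeneratingFunction ψ a b)
    {E : Type*} [TopologicalSpace E] [ContinuousENorm E] {η : Ω → E}
    (hη : AEStronglyMeasurable η P) {M : ℝ≥0∞} (h : gpsiNorm ψ a b P η ≤ M) {p : ℝ}
    (hp : p ∈ expInterval a b) : ∫⁻ ω, ‖η ω‖ₑ ∂P ≤ M * ENNReal.ofReal (ψ p) := by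
  rw [← eLpNorm_one_eq_lintegral_enorm]
  exact (eLpNorm_le_eLpNorm_of_exponent_le (by simpa using (hψ.one_lt hp).le) hη).trans
    (eLpNorm_le_of_gpsiNorm_le hψ h hp)

lemma integrable_prod_mul [SFinite μ] [IsProbabilityMeasure P] (hψ : IsGeneratingFunction ψ a b)
    (hξ : Measurable fun z : T × Ω => ξ z.1 z.2) (hsup : ∀ t, gpsiNorm ψ a b P (ξ t) ≤ 1)
    {k : T → 𝕜} (hk : Measurable k) (hki : ∫⁻ t, ‖k t‖ₑ ∂μ < ∞) :
    Integrable (fun z : T × Ω => ξ z.1 z.2 * k z.1) (μ.prod P) := by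
  have hm : Measurable fun z : T × Ω => ξ z.1 z.2 * k z.1 := hξ.mul (hk.comp measurable_fst)
  refine ⟨hm.aestronglyMeasurable, ?_⟩
  obtain ⟨p, hp⟩ := hψ.exists_mem
  rw [HasFiniteIntegral, lintegral_prod _ hm.enorm.aemeasurable]
  calc ∫⁻ t, ∫⁻ ω, ‖ξ t ω * k t‖ₑ ∂P ∂μ
      ≤ ∫⁻ t, ENNReal.ofReal (ψ p) * ‖k t‖ₑ ∂μ := by
        refine lintegral_mono fun t => ?_
        simp only [enorm_mul]
        rw [lintegral_mul_const' _ _ enorm_ne_top]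
        gcongr
        simpa using lintegral_le_of_gpsiNorm_le hψ
          (measurable_section_left hξ t).aestronglyMeasurable (hsup t) hp
    _ = ENNReal.ofReal (ψ p) * ∫⁻ t, ‖k t‖ₑ ∂μ := lintegral_const_mul' _ _ ENNReal.ofReal_ne_top
    _ < ∞ := ENNReal.mul_lt_top ENNReal.ofReal_lt_top hki

/-- This carries statements about the random functional over to the ω-averaged function on T, to
which the norming property applies. -/
lemma integral_mean_mul [SFinite μ] [IsProbabilityMeasure P] (hψ : IsGeneratingFunction ψ a b)
    (hξ : Measurable fun z : T × Ω => ξ z.1 z.2) (hsup : ∀ t, gpsiNorm ψ a b P (ξ t) ≤ 1)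
    {k : T → 𝕜} (hk : Measurable k) (hki : ∫⁻ t, ‖k t‖ₑ ∂μ < ∞) {ζ : Ω → 𝕜} (hζ : Measurable ζ)
    (hζ1 : ∀ ω, ‖ζ ω‖ ≤ 1) :
    ∫ t, (∫ ω, ζ ω * ξ t ω ∂P) * k t ∂μ = ∫ ω, ζ ω * ∫ t, ξ t ω * k t ∂μ ∂P := by
  have hi : Integrable (Function.uncurry fun t ω => ζ ω * (ξ t ω * k t)) (μ.prod P) :=
    (integrable_prod_mul hψ hξ hsup hk hki).bdd_mul
      (hζ.comp measurable_snd).aestronglyMeasurable (Eventually.of_forall fun z => hζ1 z.2)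
  have := integral_integral_swap hi
  simp only [← integral_const_mul, ← integral_mul_const]
  rw [← this]
  simp only [mul_assoc]

/-- A bound for the random functional on the extremal set extends, by duality, to the functions
which are dominated by an element of this set. -/
lemma ae_enorm_integral_le [SigmaFinite μ] [IsProbabilityMeasure P] {L : RINorm μ}
    (hL : L.ExtremalNorming 𝕜) (hD : L.extremalDiam 𝕜 < ∞) (hψ : IsGeneratingFunction ψ a b)
    (hξ : Measurable fun z : T × Ω => ξ z.1 z.2) (hsup : ∀ t, gpsiNorm ψ a b P (ξ t) ≤ 1)
    {Z : Ω → ℝ≥0∞}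
    (hZ : ∀ g ∈ L.extremalSet 𝕜, ∀ᵐ ω ∂P, ‖∫ t, ξ t ω * g t ∂μ‖ₑ ≤ Z ω)
    {g : T →ₘ[μ] 𝕜} (hg : g ∈ L.extremalSet 𝕜) {k : T → 𝕜} (hk : Measurable k)
    (hkg : ∀ t, ‖k t‖ₑ ≤ ‖g t‖ₑ) :
    ∀ᵐ ω ∂P, ‖∫ t, ξ t ω * k t ∂μ‖ₑ ≤ Z ω := by
  have hone : L.toFun (fun _ => 1) < ∞ := (RINorm.toFun_one_le_extremalDiam hL).trans_lt hD
  have hSi : ∀ g ∈ L.extremalSet 𝕜, ∫⁻ t, ‖g t‖ₑ ∂μ < ∞ := fun g hg =>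
    (RINorm.lintegral_enorm_le_extremalDiam hg).trans_lt hD
  have hki : ∫⁻ t, ‖k t‖ₑ ∂μ < ∞ := (lintegral_mono hkg).trans_lt (hSi g hg)
  set l : Ω → 𝕜 := fun ω => ∫ t, ξ t ω * k t ∂μ with hl
  have hlm : Measurable l := measurable_integral_mul hξ hk
  have hli : Integrable l P := (integrable_prod_mul hψ hξ hsup hk hki).integral_prod_right
  refine ae_le_of_forall_setLIntegral_le_of_sigmaFinite hlm.enorm fun A hA _ => ?_
  -- With ζ the conjugate phase of l on A, the integral of |l| over A is the pairing of k with φ = E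
  -- ζ ξ. Replacing |k| by |g| and using that g is in the unit ball of L' bounds this by the norm of
  -- φ, and the norming property brings it back to functionals of elements of S, which Z dominates.
  set ζ : Ω → 𝕜 := A.indicator fun ω => starRingEnd 𝕜 (l ω) / (‖l ω‖ : 𝕜) with hζ
  have hζm : Measurable ζ := (measurable_conj_div_norm.comp hlm).indicator hA
  have hζ1 : ∀ ω, ‖ζ ω‖ ≤ 1 := fun ω =>
    (norm_indicator_le_norm_self _ _).trans (norm_conj_div_norm_le _)
  set φ : T → 𝕜 := fun t => ∫ ω, ζ ω * ξ t ω ∂P with hφ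
  have hφm : Measurable φ := by
    have h1 : StronglyMeasurable fun z : T × Ω => ζ z.2 * ξ z.1 z.2 :=
      ((hζm.comp measurable_snd).mul hξ).stronglyMeasurable
    exact h1.integral_prod_right'.measurable
  have hφL : L.Mem φ := by
    obtain ⟨p, hp⟩ := hψ.exists_mem
    refine RINorm.mem_of_bounded hone hφm (C := ENNReal.ofReal (ψ p)) ENNReal.ofReal_ne_top
      (Eventually.of_forall fun t => (enorm_integral_le_lintegral_enorm _).trans ?_)
    have h2 := lintegral_le_of_gpsiNorm_le hψ
      (measurable_section_left hξ t).aestronglyMeasurable (hsup t) hp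
    rw [one_mul] at h2
    refine le_trans (lintegral_mono fun ω => ?_) h2
    rw [enorm_mul]
    refine mul_le_of_le_one_left' ?_
    rw [← ofReal_norm]
    exact ENNReal.ofReal_le_one.2 (hζ1 ω)
  have hζl : (fun ω => ζ ω * l ω) = A.indicator fun ω => (‖l ω‖ : 𝕜) := by
    ext ω
    by_cases hω : ω ∈ A
    · rw [hζ, indicator_of_mem hω, indicator_of_mem hω]
      exact conj_div_norm_mul_self _
    · rw [hζ, indicator_of_notMem hω, indicator_of_notMem hω, zero_mul]
  calc ∫⁻ ω in A, ‖l ω‖ₑ ∂P = ‖∫ t, φ t * k t ∂μ‖ₑ := by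
        rw [integral_mean_mul hψ hξ hsup hk hki hζm hζ1, ← enorm_integral_norm_eq hli.integrableOn,
          ← integral_indicator hA, ← hζl]
    _ ≤ ∫⁻ t, ‖φ t * k t‖ₑ ∂μ := enorm_integral_le_lintegral_enorm _
    _ ≤ ∫⁻ t, ‖φ t‖ₑ * ‖g t‖ₑ ∂μ := by
        refine lintegral_mono fun t => ?_
        rw [enorm_mul]
        gcongr
        exact hkg t
    _ ≤ L.norm φ := RINorm.lintegral_mul_le hg.1 hφm.enorm
    _ ≤ ∫⁻ ω in A, Z ω ∂P := by
        rw [hL φ hφL]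
        refine iSup₂_le fun g' hg' => ?_
        rw [integral_mean_mul hψ hξ hsup g'.measurable (hSi g' hg') hζm hζ1]
        calc _ ≤ ENNReal.ofReal ‖∫ ω, ζ ω * ∫ t, ξ t ω * g' t ∂μ ∂P‖ :=
              ENNReal.ofReal_le_ofReal (RCLike.re_le_norm _)
          _ = ‖∫ ω, ζ ω * ∫ t, ξ t ω * g' t ∂μ ∂P‖ₑ := ofReal_norm _
          _ ≤ ∫⁻ ω, ‖ζ ω * ∫ t, ξ t ω * g' t ∂μ‖ₑ ∂P := enorm_integral_le_lintegral_enorm _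
          _ ≤ ∫⁻ ω, A.indicator Z ω ∂P := by
              refine lintegral_mono_ae ?_
              filter_upwards [hZ g' hg'] with ω hω
              by_cases hωA : ω ∈ A
              · rw [indicator_of_mem hωA, enorm_mul]
                refine le_trans (mul_le_of_le_one_left' ?_) hω
                rw [← ofReal_norm]
                exact ENNReal.ofReal_le_one.2 (hζ1 ω)
              · rw [hζ, indicator_of_notMem hωA, zero_mul, enorm_zero]
                exact zero_le
          _ = _ := lintegral_indicator hA _

/-- A majorant of the random functional on the extremal set is a majorant of the norm of the
sample functions. -/
lemma ae_norm_le_of_majorant [SigmaFinite μ] [IsSeparable μ] [IsProbabilityMeasure P]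
    {L : RINorm μ} (hL : L.ExtremalNorming 𝕜) (hD : L.extremalDiam 𝕜 < ∞)
    (hS : (L.extremalSet 𝕜).Nonempty) (hψ : IsGeneratingFunction ψ a b)
    (hξ : Measurable fun z : T × Ω => ξ z.1 z.2) (hsup : ∀ t, gpsiNorm ψ a b P (ξ t) ≤ 1)
    {Z : Ω → ℝ≥0∞}
    (hZ : ∀ g ∈ L.extremalSet 𝕜, ∀ᵐ ω ∂P, ‖∫ t, ξ t ω * g t ∂μ‖ₑ ≤ Z ω) :
    ∀ᵐ ω ∂P, L.norm (fun t => ξ t ω) ≤ Z ω := by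
  have hone : L.toFun (fun _ => 1) < ∞ := (RINorm.toFun_one_le_extremalDiam hL).trans_lt hD
  obtain ⟨g, hgS, hg⟩ := RINorm.exists_seq_norm_eq hL hD hone hS
  obtain ⟨h, hhm, hh1, hh⟩ := exists_seq_norming_L1 μ 𝕜
  have h1 : ∀ᵐ ω ∂P, ∀ n m, ‖∫ t, ξ t ω * (g n t * h m t) ∂μ‖ₑ ≤ Z ω := by
    rw [ae_all_iff]
    intro n
    rw [ae_all_iff]
    intro m
    refine ae_enorm_integral_le hL hD hψ hξ hsup hZ (hgS n) ((g n).measurable.mul (hhm m))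
      fun t => ?_
    rw [enorm_mul]
    refine mul_le_of_le_one_right' ?_
    rw [← ofReal_norm]
    exact ENNReal.ofReal_le_one.2 (hh1 m t)
  have h2 : ∀ᵐ ω ∂P, ∀ n, Integrable (fun t => ξ t ω * g n t) μ := by
    rw [ae_all_iff]
    intro n
    exact (integrable_prod_mul hψ hξ hsup (g n).measurable
      ((RINorm.lintegral_enorm_le_extremalDiam (hgS n)).trans_lt hD)).prod_left_ae
  filter_upwards [h1, h2] with ω hω1 hω2
  rw [hg _ (measurable_section_right hξ ω)]
  refine iSup_le fun m => iSup_le fun n => ?_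
  -- For fixed ω the full integral of |ξ g| is bounded by Z(ω), which absorbs the ω-dependent
  -- truncation.
  have h3 := hh _ (hω2 n) (Z ω) fun m => by simpa only [mul_assoc] using hω1 n m
  calc _ ≤ ENNReal.ofReal ‖∫ t, {t | ‖ξ t ω‖ ≤ m}.indicator (fun t => ξ t ω) t * g n t ∂μ‖ :=
        ENNReal.ofReal_le_ofReal (RCLike.re_le_norm _)
    _ = ‖∫ t, {t | ‖ξ t ω‖ ≤ m}.indicator (fun t => ξ t ω) t * g n t ∂μ‖ₑ := ofReal_norm _
    _ ≤ ∫⁻ t, ‖{t | ‖ξ t ω‖ ≤ m}.indicator (fun t => ξ t ω) t * g n t‖ₑ ∂μ :=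
        enorm_integral_le_lintegral_enorm _
    _ ≤ ∫⁻ t, ‖ξ t ω * g n t‖ₑ ∂μ := by
        refine lintegral_mono fun t => ?_
        rw [enorm_mul, enorm_mul]
        gcongr
        exact enorm_indicator_le_enorm_self _ _
    _ ≤ Z ω := h3

/-- The countable formula for the norm involves only truncated paths, which are jointly measurable.
-/
lemma measurable_norm_path [SigmaFinite μ] [IsSeparable μ] {L : RINorm μ}
    (hL : L.ExtremalNorming 𝕜) (hD : L.extremalDiam 𝕜 < ∞)
    (hS : (L.extremalSet 𝕜).Nonempty) (hξ : Measurable fun z : T × Ω => ξ z.1 z.2) :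
    Measurable fun ω => L.norm fun t => ξ t ω := by
  have hone : L.toFun (fun _ => 1) < ∞ := (RINorm.toFun_one_le_extremalDiam hL).trans_lt hD
  obtain ⟨g, -, hg⟩ := RINorm.exists_seq_norm_eq hL hD hone hS
  simp only [hg _ (measurable_section_right hξ _)]
  refine Measurable.iSup fun m => Measurable.iSup fun n => ENNReal.measurable_ofReal.comp
    (RCLike.continuous_re.measurable.comp ?_)
  refine measurable_integral_mul
    (ξ := fun t ω => {t | ‖ξ t ω‖ ≤ m}.indicator (fun t => ξ t ω) t) ?_ (g n).measurable
  exact hξ.indicator (s := {z : T × Ω | ‖ξ z.1 z.2‖ ≤ m})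
    (measurableSet_le hξ.norm measurable_const)

/-- A pointwise majorant of the field bounds the norm of almost every sample function. -/
lemma ae_mem_of_majorant [SigmaFinite μ] [SFinite P] {L : RINorm μ}
    (hone : L.toFun (fun _ => 1) < ∞) (hξ : Measurable fun z : T × Ω => ξ z.1 z.2)
    {Z : Ω → ℝ≥0∞} (hZm : AEMeasurable Z P) (hZ : ∀ t, ∀ᵐ ω ∂P, ‖ξ t ω‖ₑ ≤ Z ω)
    (hZt : ∀ᵐ ω ∂P, Z ω < ∞) : ∀ᵐ ω ∂P, L.Mem fun t => ξ t ω := by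
  -- Exchanging the quantifiers over t and ω requires a measurable exceptional set, hence the
  -- measurable version of Z.
  have hset : MeasurableSet {x : T × Ω | ‖ξ x.1 x.2‖ₑ ≤ hZm.mk Z x.2} :=
    measurableSet_le hξ.enorm (hZm.measurable_mk.comp measurable_snd)
  have h1 : ∀ᵐ ω ∂P, ∀ᵐ t ∂μ, ‖ξ t ω‖ₑ ≤ hZm.mk Z ω := by
    rw [← Measure.ae_ae_comm (p := fun t ω => ‖ξ t ω‖ₑ ≤ hZm.mk Z ω) hset]
    refine Eventually.of_forall fun t => ?_
    filter_upwards [hZ t, hZm.ae_eq_mk] with ω h2 h3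
    rwa [← h3]
  filter_upwards [h1, hZt, hZm.ae_eq_mk] with ω h2 h3 h4
  exact RINorm.mem_of_bounded hone (measurable_section_right hξ ω) (h4 ▸ h3.ne) h2

lemma ae_lt_top_of_gpsiNorm_lt_top [IsProbabilityMeasure P] (hψ : IsGeneratingFunction ψ a b)
    {Z : Ω → ℝ≥0∞} (hZm : AEMeasurable Z P) (h : gpsiNorm ψ a b P Z < ∞) :
    ∀ᵐ ω ∂P, Z ω < ∞ := by
  obtain ⟨p, hp⟩ := hψ.exists_mem
  refine ae_lt_top' hZm (ne_top_of_le_ne_top (ENNReal.mul_ne_top h.ne ENNReal.ofReal_ne_top)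
    (lintegral_le_of_gpsiNorm_le hψ hZm.aestronglyMeasurable le_rfl hp))

end RandomField

theorem theorem3p1 {𝕜 : Type*} [RCLike 𝕜] {T Ω : Type*} [MeasurableSpace T] [MeasurableSpace Ω]
    (μ : Measure T) [SigmaFinite μ] [IsSeparable μ] (P : Measure Ω) [IsProbabilityMeasure P]
    (L : RINorm μ) (hL : L.ExtremalNorming 𝕜)
    (ψ : ℝ → ℝ) (a : ℝ) (b : EReal) (hψ : IsGeneratingFunction ψ a b)
    (ξ : T → Ω → 𝕜) (hξ : Measurable (fun z : T × Ω => ξ z.1 z.2))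
    (hint : ∀ g ∈ L.assoc 𝕜, ∀ᵐ ω ∂P, Integrable (fun t => ξ t ω * g t) μ)
    (hsup : ⨆ t, gpsiNorm ψ a b P (ξ t) = 1) :
    (entropyIntegral ψ a b (L.extremalDiam 𝕜) (naturalDist ψ a b P ξ) < ∞ →
      ∀ᵐ ω ∂P, L.Mem (fun t => ξ t ω)) ∧
    (entropyIntegral ψ a b (L.extremalDiam 𝕜)
        (naturalDist ψ a b P (fun g : L.extremalSet 𝕜 => pathFunctional ξ (g : T →ₘ[μ] 𝕜))) < ∞ →
      (∀ᵐ ω ∂P, L.Mem (fun t => ξ t ω)) ∧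
      AEMeasurable (fun ω => L.norm (fun t => ξ t ω)) P ∧
      gpsiNorm ψ a b P (fun ω => L.norm (fun t => ξ t ω)) ≤
        9 * entropyIntegral ψ a b (L.extremalDiam 𝕜)
          (naturalDist ψ a b P
            (fun g : L.extremalSet 𝕜 => pathFunctional ξ (g : T →ₘ[μ] 𝕜)))) := by
  have hsup' : ∀ t, gpsiNorm ψ a b P (ξ t) ≤ 1 := fun t => hsup ▸
    le_iSup (fun t => gpsiNorm ψ a b P (ξ t)) t
  have hT : Nonempty T := by
    by_contra h
    rw [not_nonempty_iff] at h
    simp at hsup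
  -- If D = 0, the constant 1 has norm 0, so μ = 0 and every path has norm 0. This also covers empty
  -- S, leaving S nonempty afterwards.
  rcases eq_or_ne (L.extremalDiam 𝕜) 0 with hD0 | hD0
  · have h1 : L.toFun (fun _ => 1) = 0 :=
      nonpos_iff_eq_zero.1 ((RINorm.toFun_one_le_extremalDiam hL).trans_eq hD0)
    have h2 := (L.eq_zero_iff _ measurable_const).1 h1
    have h3 : ∀ ω, L.norm (fun t => ξ t ω) = 0 := by
      intro ω
      refine (L.eq_zero_iff _ (measurable_section_right hξ ω).enorm).2 ?_
      filter_upwards [h2] with t ht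
      exact absurd ht one_ne_zero
    have h4 : ∀ᵐ ω ∂P, L.Mem fun t => ξ t ω := Filter.Eventually.of_forall fun ω =>
      ⟨measurable_section_right hξ ω, by rw [h3]; exact ENNReal.zero_lt_top⟩
    refine ⟨fun _ => h4, fun _ => ⟨h4, by simp only [h3]; exact aemeasurable_const, ?_⟩⟩
    simp only [h3]
    have h0 : gpsiNorm ψ a b P (fun _ => (0 : ℝ≥0∞)) = 0 := by simp [gpsiNorm]
    rw [h0]
    exact zero_le
  have hS : (L.extremalSet 𝕜).Nonempty := by
    by_contra h
    rw [not_nonempty_iff_eq_empty] at h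
    exact hD0 (by simp [RINorm.extremalDiam, h])
  have hDpos : L.extremalDiam 𝕜 < ∞ → 0 < (L.extremalDiam 𝕜).toReal := fun h =>
    ENNReal.toReal_pos hD0 h.ne
  refine ⟨fun hI => ?_, fun hI => ?_⟩
  · have hD := lt_top_of_entropyIntegral_lt_top hψ hI
    have hone := (RINorm.toFun_one_le_extremalDiam hL).trans_lt hD
    set D := (L.extremalDiam 𝕜).toReal with hDD
    have hDr : ENNReal.ofReal D = L.extremalDiam 𝕜 := ENNReal.ofReal_toReal hD.ne
    rw [← hDr] at hI
    -- The factor 1 + 1/D is at least 1 and makes the product with D at least 1. Only its finiteness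
    -- matters, since (i) claims no norm bound.
    have hM : ∀ t, gpsiNorm ψ a b P (ξ t) ≤ (1 + (ENNReal.ofReal D)⁻¹) * ENNReal.ofReal D := by
      intro t
      refine (hsup' t).trans ?_
      rw [add_mul, ENNReal.inv_mul_cancel (by simpa using hDpos hD) ENNReal.ofReal_ne_top]
      exact le_add_self
    obtain ⟨Z, hZm, hZ, hZn⟩ := exists_majorant_of_entropyIntegral hψ
      (fun t => (measurable_section_left hξ t).aestronglyMeasurable) (hDpos hD) hI le_self_add hM
    refine ae_mem_of_majorant hone hξ hZm hZ
      (ae_lt_top_of_gpsiNorm_lt_top hψ hZm (hZn.trans_lt ?_))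
    refine ENNReal.mul_lt_top (ENNReal.mul_lt_top (by norm_num) ?_) hI
    exact ENNReal.add_lt_top.2 ⟨ENNReal.one_lt_top, ENNReal.inv_lt_top.2 (by simpa using hDpos hD)⟩
  · have hSn : Nonempty (L.extremalSet 𝕜) := hS.to_subtype
    have hD := lt_top_of_entropyIntegral_lt_top hψ hI
    set D := (L.extremalDiam 𝕜).toReal with hDD
    have hDr : ENNReal.ofReal D = L.extremalDiam 𝕜 := ENNReal.ofReal_toReal hD.ne
    rw [← hDr] at hI ⊢
    -- On S, Minkowski's inequality bounds each Gψ norm by ∫|g| ≤ D, so M = 1 is allowed and the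
    -- resulting constant is 4, within the required 9.
    obtain ⟨Z, hZm, hZ, hZn⟩ := exists_majorant_of_entropyIntegral (M := 1) hψ
      (Y := fun g : L.extremalSet 𝕜 => pathFunctional ξ (g : T →ₘ[μ] 𝕜))
      (fun g => (measurable_integral_mul hξ g.1.measurable).aestronglyMeasurable) (hDpos hD) hI
      le_rfl (fun g => by
        rw [one_mul, hDr]
        exact (gpsiNorm_integral_mul_le hψ hξ hsup' g.1.measurable).trans
          (RINorm.lintegral_enorm_le_extremalDiam g.2))
    have hle := ae_norm_le_of_majorant hL hD hS hψ hξ hsup' fun g hg => hZ ⟨g, hg⟩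
    rw [mul_one] at hZn
    have hZt := ae_lt_top_of_gpsiNorm_lt_top hψ hZm
      (hZn.trans_lt (ENNReal.mul_lt_top (by norm_num) hI))
    refine ⟨?_, (measurable_norm_path hL hD hS hξ).aemeasurable, ?_⟩
    · filter_upwards [hle, hZt] with ω h1 h2
      exact ⟨measurable_section_right hξ ω, h1.trans_lt h2⟩
    · refine (gpsiNorm_mono_ae hψ (ζ := Z) ?_).trans (hZn.trans ?_)
      · simpa only [enorm_eq_self] using hle
      · gcongr
        norm_num
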